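/- Let $Y$ be a topological space (a set is regarded as a discrete space). For $n\ge 1$ let $\mathrm{NAP}_Y(n)$ be the set of rooted trees with vertex set $\{1,\dots,n\}$ whose edges are labelled by elements of $Y$, topologised as the disjoint union, over all rooted trees $T$ on $\{1,\dots,n\}$, of the products $Y^{E(T)}$, where $E(T)$ is the edge set of $T$. The symmetric group acts by renaming vertices, and for $T_1\in\mathrm{NAP}_Y(n)$, $T_2\in\mathrm{NAP}_Y(m)$, $1\le i\le n$, the partial composite $T_1\circ_i T_2\in\mathrm{NAP}_Y(n+m-1)$ is obtained by identifying the root of $T_2$ with the vertex $i$ of $T_1$, keeping the root of $T_1$ and all edge labels, and renumbering the vertices: $1,\dots,i-1$ of $T_1$ are fixed, $1,\dots,m$ of $T_2$ become $i,\dots,i+m-1$, and $i+1,\dots,n$ of $T_1$ become $i+m,\dots,n+m-1$. These data form a symmetric operad. Then $\mathrm{NAP}_Y$ is a topological operad, it is generated by its binary operations, and it is presented by its quadratic relations. More precisely, let $F$ be the free symmetric operad on the $\mathbb S_2$-space $\mathrm{NAP}_Y(2)$ (placed in arity $2$). 1. Every element of $\mathrm{NAP}_Y$ is obtained from elements of $\mathrm{NAP}_Y(2)$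 and the operad unit by partial compositions and permutations. 2. Let $R$ be the set of all pairs $(x,x')$ of elements of $F$ of the same arity, each of weight $2$ (that is, using exactly two generators), which have the same value in $\mathrm{NAP}_Y$. Then the canonical morphism from $F$ to $\mathrm{NAP}_Y$ induces an isomorphism of topological operads $F/(R)\cong\mathrm{NAP}_Y$, where $(R)$ is the operadic ideal (congruence) generated by $R$. 3. The same holds with $R$ replaced by the relations $\mu_y\circ_1\mu_z=(\mu_z\circ_1\mu_y).(2\,3)$ for all $y,z\in Y$, where $\mu_y\in\mathrm{NAP}_Y(2)$ is the tree with root $1$ whose only edge, joining $1$ and $2$, is labelled by $y$. In 2 and 3, $F/(R)$ is the topological operad presented by the space of generators $\mathrm{NAP}_Y(2)$ and the relations $R$: its topology is the finest one which makes it a topological operad and makes the map from $\mathrm{NAP}_Y(2)$ to it continuous. In particular, for any set $Y$ it is an isomorphism of operads in sets. -/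

import Mathlib

namespace TreeOperad

universe u v

/-! ### Symmetric operads in sets, given by partial compositions -/

/-- A symmetric collection of sets. A permutation acts on the left, by renaming inputs;
the right action is `x.σ = act σ⁻¹ x`. -/
structure SymCollection : Type (u + 1) where
  X : ℕ → Type u
  act : ∀ {n : ℕ}, Equiv.Perm (Fin n) → X n → X n
  act_one : ∀ {n : ℕ} (x : X n), act 1 x = x
  act_mul : ∀ {n : ℕ} (σ τ : Equiv.Perm (Fin n)) (x : X n), act (σ * τ) x = act σ (act τ x)

/-- When an operation with `m` inputs is inserted at the input `i` of one with `n` inputs, the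
input `j` of the inner operation becomes the input `i + j` of the composite (inputs are
numbered from `0`). -/
def inner {n m k : ℕ} (h : k + 1 = n + m) (i : Fin n) (j : Fin m) : Fin k :=
  ⟨i.1 + j.1, by omega⟩

/-- When an operation with `m` inputs is inserted at the input `i` of one with `n` inputs, an
input `j ≠ i` of the outer operation stays in place if `j < i`, and is shifted by `m - 1` if
`i < j`. -/
def outer {n m k : ℕ} (h : k + 1 = n + m) (i : Fin n) (j : {j : Fin n // j ≠ i}) : Fin k :=
  if hj : j.1.1 < i.1 then ⟨j.1.1, by omega⟩
  else ⟨j.1.1 + m - 1, by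
    have := j.1.2
    have := Fin.val_ne_of_ne j.2
    omega⟩

theorem bijective_outer_inner {n m k : ℕ} (h : k + 1 = n + m) (i : Fin n) :
    Function.Bijective (Sum.elim (outer h i) (inner (m := m) h i)) := by
  constructor
  · rintro (⟨a, ha⟩ | a) (⟨b, hb⟩ | b) hab
    · have ha' := Fin.val_ne_of_ne ha
      have hb' := Fin.val_ne_of_ne hb
      simp only [Sum.elim_inl, outer, Fin.ext_iff, apply_dite Fin.val] at hab
      have : a.1 = b.1 := by split_ifs at hab <;> omega
      simp [Fin.ext_iff, this]
    · have ha' := Fin.val_ne_of_ne ha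
      simp only [Sum.elim_inl, Sum.elim_inr, outer, inner, Fin.ext_iff, apply_dite Fin.val] at hab
      split_ifs at hab <;> omega
    · have hb' := Fin.val_ne_of_ne hb
      simp only [Sum.elim_inl, Sum.elim_inr, outer, inner, Fin.ext_iff, apply_dite Fin.val] at hab
      split_ifs at hab <;> omega
    · simp only [Sum.elim_inr, inner, Fin.ext_iff] at hab
      have : a.1 = b.1 := by omega
      simp [Fin.ext_iff, this]
  · intro c
    by_cases h1 : c.1 < i.1
    · refine ⟨Sum.inl ⟨⟨c.1, by omega⟩, ?_⟩, ?_⟩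
      · simp [Fin.ext_iff]; omega
      · simp [outer, h1]
    · by_cases h2 : c.1 < i.1 + m
      · exact ⟨Sum.inr ⟨c.1 - i.1, by omega⟩, by simp [inner, Fin.ext_iff]; omega⟩
      · refine ⟨Sum.inl ⟨⟨c.1 + 1 - m, by omega⟩, ?_⟩, ?_⟩
        · simp [Fin.ext_iff]; omega
        · have : ¬ (c.1 + 1 - m < i.1) := by omega
          simp only [Sum.elim_inl, outer, this, dite_false, Fin.ext_iff]
          omega

/-- The inputs of a partial composite are the inputs other than `i` of the outer operation
together with the inputs of the inner one. -/
noncomputable def inputEquiv {n m k : ℕ} (h : k + 1 = n + m) (i : Fin n) :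
    {j : Fin n // j ≠ i} ⊕ Fin m ≃ Fin k :=
  Equiv.ofBijective _ (bijective_outer_inner h i)

/-- The permutation of the inputs of a composite induced by the permutations `σ` and `τ` of the
inputs of the two factors. -/
noncomputable def blockPerm {n m k : ℕ} (h : k + 1 = n + m) (i : Fin n)
    (σ : Equiv.Perm (Fin n)) (τ : Equiv.Perm (Fin m)) : Equiv.Perm (Fin k) :=
  (inputEquiv h i).symm.trans
    ((Equiv.sumCongr (σ.subtypeEquiv fun a => by simp) τ).trans (inputEquiv h (σ i)))

theorem blockPerm_inner {n m k : ℕ} (h : k + 1 = n + m) (i : Fin n)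
    (σ : Equiv.Perm (Fin n)) (τ : Equiv.Perm (Fin m)) (j : Fin m) :
    blockPerm h i σ τ (inner h i j) = inner h (σ i) (τ j) := by
  have : (inputEquiv h i).symm (inner h i j) = Sum.inr j := by
    rw [Equiv.symm_apply_eq]; rfl
  simp [blockPerm, this]
  rfl

theorem blockPerm_outer {n m k : ℕ} (h : k + 1 = n + m) (i : Fin n)
    (σ : Equiv.Perm (Fin n)) (τ : Equiv.Perm (Fin m)) (j : {j : Fin n // j ≠ i}) :
    blockPerm h i σ τ (outer h i j) = outer h (σ i) ⟨σ j.1, by simpa using j.2⟩ := by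
  have : (inputEquiv h i).symm (outer h i j) = Sum.inl j := by
    rw [Equiv.symm_apply_eq]; rfl
  simp [blockPerm, this]
  rfl

/-- A symmetric operad in sets. The element `comp h i x y` is the partial composite `x ∘ᵢ y`,
of arity `k = n + m - 1`; inputs are numbered from `0`. -/
structure Operad : Type (u + 1) extends SymCollection.{u} where
  one : X 1
  comp : ∀ {n m k : ℕ}, k + 1 = n + m → Fin n → X n → X m → X k
  comp_one : ∀ {n : ℕ} (i : Fin n) (x : X n), comp rfl i x one = x
  one_comp : ∀ {n : ℕ} (x : X n), comp (Nat.add_comm n 1) 0 one x = x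
  /-- `x ∘ᵢ (y ∘ⱼ z) = (x ∘ᵢ y) ∘ᵢ₊ⱼ z` -/
  comp_seq : ∀ {n₁ n₂ n₃ a b k : ℕ} (h₁₂ : a + 1 = n₁ + n₂) (h₂₃ : b + 1 = n₂ + n₃)
    (h : k + 1 = a + n₃) (h' : k + 1 = n₁ + b) (i : Fin n₁) (j : Fin n₂)
    (x : X n₁) (y : X n₂) (z : X n₃),
    comp h' i x (comp h₂₃ j y z) =
      comp h ⟨i.1 + j.1, by omega⟩ (comp h₁₂ i x y) z
  /-- `(x ∘ⱼ y) ∘ᵢ z = (x ∘ᵢ z) ∘ y` at the shifted position `j + n₃ - 1`, for `i < j` -/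
  comp_par : ∀ {n₁ n₂ n₃ a b k : ℕ} (h₁₂ : a + 1 = n₁ + n₂) (h₁₃ : b + 1 = n₁ + n₃)
    (h : k + 1 = a + n₃) (h' : k + 1 = b + n₂) (i j : Fin n₁) (hij : i.1 < j.1)
    (x : X n₁) (y : X n₂) (z : X n₃),
    comp h ⟨i.1, by omega⟩ (comp h₁₂ j x y) z =
      comp h' ⟨j.1 + n₃ - 1, by omega⟩ (comp h₁₃ i x z) y
  comp_act : ∀ {n m k : ℕ} (h : k + 1 = n + m) (i : Fin n)
    (σ : Equiv.Perm (Fin n)) (τ : Equiv.Perm (Fin m)) (x : X n) (y : X m),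
    comp h (σ i) (act σ x) (act τ y) = act (blockPerm h i σ τ) (comp h i x y)

/-- A morphism of symmetric collections. -/
structure SymCollection.Hom (E : SymCollection.{u}) (F : SymCollection.{v}) where
  toFun : ∀ {n : ℕ}, E.X n → F.X n
  map_act : ∀ {n : ℕ} (σ : Equiv.Perm (Fin n)) (x : E.X n), toFun (E.act σ x) = F.act σ (toFun x)

/-- A morphism of operads. -/
structure Operad.Hom (O : Operad.{u}) (P : Operad.{v}) extends
    SymCollection.Hom O.toSymCollection P.toSymCollection where
  map_one : toFun O.one = P.one
  map_comp : ∀ {n m k : ℕ} (h : k + 1 = n + m) (i : Fin n) (x : O.X n) (y : O.X m),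
    toFun (O.comp h i x y) = P.comp h i (toFun x) (toFun y)

/-! ### Free operads -/

/-- Formal operadic expressions in the elements of a collection. -/
inductive Term (X : ℕ → Type u) : ℕ → Type u
  | gen {n : ℕ} (e : X n) : Term X n
  | one : Term X 1
  | act {n : ℕ} (σ : Equiv.Perm (Fin n)) (x : Term X n) : Term X n
  | comp {n m k : ℕ} (h : k + 1 = n + m) (i : Fin n) (x : Term X n) (y : Term X m) : Term X k

/-- The least equivalence relation on expressions that is compatible with the operations,
contains all instances of the operad axioms, and identifies the action of a permutation on a
generator with its formal action. -/
inductive TermRel (E : SymCollection.{u}) : ∀ {n : ℕ}, Term E.X n → Term E.X n → Prop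
  | refl {n : ℕ} (x : Term E.X n) : TermRel E x x
  | symm {n : ℕ} {x y : Term E.X n} : TermRel E x y → TermRel E y x
  | trans {n : ℕ} {x y z : Term E.X n} : TermRel E x y → TermRel E y z → TermRel E x z
  | congr_act {n : ℕ} (σ : Equiv.Perm (Fin n)) {x y : Term E.X n} :
      TermRel E x y → TermRel E (.act σ x) (.act σ y)
  | congr_comp {n m k : ℕ} (h : k + 1 = n + m) (i : Fin n) {x x' : Term E.X n}
      {y y' : Term E.X m} : TermRel E x x' → TermRel E y y' →
      TermRel E (.comp h i x y) (.comp h i x' y')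
  | gen_act {n : ℕ} (σ : Equiv.Perm (Fin n)) (e : E.X n) :
      TermRel E (.gen (E.act σ e)) (.act σ (.gen e))
  | act_one {n : ℕ} (x : Term E.X n) : TermRel E (.act 1 x) x
  | act_mul {n : ℕ} (σ τ : Equiv.Perm (Fin n)) (x : Term E.X n) :
      TermRel E (.act (σ * τ) x) (.act σ (.act τ x))
  | comp_one {n : ℕ} (i : Fin n) (x : Term E.X n) : TermRel E (.comp rfl i x .one) x
  | one_comp {n : ℕ} (x : Term E.X n) : TermRel E (.comp (Nat.add_comm n 1) 0 .one x) x
  | comp_seq {n₁ n₂ n₃ a b k : ℕ} (h₁₂ : a + 1 = n₁ + n₂) (h₂₃ : b + 1 = n₂ + n₃)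
      (h : k + 1 = a + n₃) (h' : k + 1 = n₁ + b) (i : Fin n₁) (j : Fin n₂)
      (x : Term E.X n₁) (y : Term E.X n₂) (z : Term E.X n₃) :
      TermRel E (.comp h' i x (.comp h₂₃ j y z))
        (.comp h ⟨i.1 + j.1, by omega⟩ (.comp h₁₂ i x y) z)
  | comp_par {n₁ n₂ n₃ a b k : ℕ} (h₁₂ : a + 1 = n₁ + n₂) (h₁₃ : b + 1 = n₁ + n₃)
      (h : k + 1 = a + n₃) (h' : k + 1 = b + n₂) (i j : Fin n₁) (hij : i.1 < j.1)
      (x : Term E.X n₁) (y : Term E.X n₂) (z : Term E.X n₃) :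
      TermRel E (.comp h ⟨i.1, by omega⟩ (.comp h₁₂ j x y) z)
        (.comp h' ⟨j.1 + n₃ - 1, by omega⟩ (.comp h₁₃ i x z) y)
  | comp_act {n m k : ℕ} (h : k + 1 = n + m) (i : Fin n)
      (σ : Equiv.Perm (Fin n)) (τ : Equiv.Perm (Fin m)) (x : Term E.X n) (y : Term E.X m) :
      TermRel E (.comp h (σ i) (.act σ x) (.act τ y))
        (.act (blockPerm h i σ τ) (.comp h i x y))

def termSetoid (E : SymCollection.{u}) (n : ℕ) : Setoid (Term E.X n) where
  r := TermRel E
  iseqv := ⟨.refl, .symm, .trans⟩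

/-- The free operad on a symmetric collection. -/
def freeOperad (E : SymCollection.{u}) : Operad.{u} where
  X n := Quotient (termSetoid E n)
  act σ := Quotient.map (.act σ) fun _ _ h => TermRel.congr_act σ h
  act_one := by
    rintro n ⟨x⟩
    exact Quotient.sound (s := termSetoid E n) (TermRel.act_one x)
  act_mul := by
    rintro n σ τ ⟨x⟩
    exact Quotient.sound (s := termSetoid E n) (TermRel.act_mul σ τ x)
  one := Quotient.mk _ .one
  comp h i := Quotient.map₂ (.comp h i) fun _ _ hx _ _ hy => TermRel.congr_comp h i hx hy
  comp_one := by
    rintro n i ⟨x⟩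
    exact Quotient.sound (s := termSetoid E n) (TermRel.comp_one i x)
  one_comp := by
    rintro n ⟨x⟩
    exact Quotient.sound (s := termSetoid E n) (TermRel.one_comp x)
  comp_seq := by
    rintro n₁ n₂ n₃ a b k h₁₂ h₂₃ h h' i j ⟨x⟩ ⟨y⟩ ⟨z⟩
    exact Quotient.sound (s := termSetoid E k) (TermRel.comp_seq h₁₂ h₂₃ h h' i j x y z)
  comp_par := by
    rintro n₁ n₂ n₃ a b k h₁₂ h₁₃ h h' i j hij ⟨x⟩ ⟨y⟩ ⟨z⟩
    exact Quotient.sound (s := termSetoid E k) (TermRel.comp_par h₁₂ h₁₃ h h' i j hij x y z)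
  comp_act := by
    rintro n m k h i σ τ ⟨x⟩ ⟨y⟩
    exact Quotient.sound (s := termSetoid E k) (TermRel.comp_act h i σ τ x y)

/-- The inclusion of the generators. -/
def freeGen (E : SymCollection.{u}) : E.Hom (freeOperad E).toSymCollection where
  toFun e := Quotient.mk _ (.gen e)
  map_act σ e := Quotient.sound (s := termSetoid E _) (TermRel.gen_act σ e)

/-- The value of an expression in an operad. -/
def Term.eval {E : SymCollection.{u}} {O : Operad.{v}} (f : E.Hom O.toSymCollection) :
    ∀ {n : ℕ}, Term E.X n → O.X n
  | _, .gen e => f.toFun e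
  | _, .one => O.one
  | _, .act σ x => O.act σ (x.eval f)
  | _, .comp h i x y => O.comp h i (x.eval f) (y.eval f)

theorem TermRel.eval_eq {E : SymCollection.{u}} {O : Operad.{v}} (f : E.Hom O.toSymCollection)
    {n : ℕ} {x y : Term E.X n} (h : TermRel E x y) : x.eval f = y.eval f := by
  induction h with
  | refl x => rfl
  | symm _ ih => exact ih.symm
  | trans _ _ ih₁ ih₂ => exact ih₁.trans ih₂
  | congr_act σ _ ih => simp only [Term.eval, ih]
  | congr_comp h i _ _ ih₁ ih₂ => simp only [Term.eval, ih₁, ih₂]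
  | gen_act σ e => exact f.map_act σ e
  | act_one x => exact O.act_one _
  | act_mul σ τ x => exact O.act_mul _ _ _
  | comp_one i x => exact O.comp_one _ _
  | one_comp x => exact O.one_comp _
  | comp_seq h₁₂ h₂₃ h h' i j x y z => exact O.comp_seq h₁₂ h₂₃ h h' i j _ _ _
  | comp_par h₁₂ h₁₃ h h' i j hij x y z => exact O.comp_par h₁₂ h₁₃ h h' i j hij _ _ _
  | comp_act h i σ τ x y => exact O.comp_act h i σ τ _ _

/-- The morphism out of the free operad that extends a map of collections. -/
def freeLift {E : SymCollection.{u}} {O : Operad.{v}} (f : E.Hom O.toSymCollection) :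
    (freeOperad E).Hom O where
  toFun := Quotient.lift (Term.eval f) fun _ _ h => TermRel.eval_eq f h
  map_act := by rintro n σ ⟨x⟩; rfl
  map_one := rfl
  map_comp := by rintro n m k h i ⟨x⟩ ⟨y⟩; rfl

/-- The number of generators used in an expression. -/
def Term.weight {X : ℕ → Type u} : ∀ {n : ℕ}, Term X n → ℕ
  | _, .gen _ => 1
  | _, .one => 0
  | _, .act _ x => x.weight
  | _, .comp _ _ x y => x.weight + y.weight

theorem TermRel.weight_eq {E : SymCollection.{u}} {n : ℕ} {x y : Term E.X n}
    (h : TermRel E x y) : x.weight = y.weight := by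
  induction h <;> first | rfl | (simp only [Term.weight]; omega) | omega

/-- The weight of an element of a free operad. -/
def weight {E : SymCollection.{u}} {n : ℕ} : (freeOperad E).X n → ℕ :=
  Quotient.lift Term.weight fun _ _ h => TermRel.weight_eq h

/-! ### Generation, ideals and quotients -/

/-- Membership in the suboperad generated by a family of subsets of an operad. -/
inductive Operad.Generated (O : Operad.{u}) (S : ∀ n : ℕ, Set (O.X n)) :
    ∀ {n : ℕ}, O.X n → Prop
  | of {n : ℕ} {x : O.X n} : x ∈ S n → O.Generated S x
  | one : O.Generated S O.one
  | act {n : ℕ} (σ : Equiv.Perm (Fin n)) {x : O.X n} : O.Generated S x → O.Generated S (O.act σ x)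
  | comp {n m k : ℕ} (h : k + 1 = n + m) (i : Fin n) {x : O.X n} {y : O.X m} :
      O.Generated S x → O.Generated S y → O.Generated S (O.comp h i x y)

/-- A family of relations between elements of the same arity of an operad. -/
abbrev Operad.Relations (O : Operad.{u}) : Type u := ∀ n : ℕ, O.X n → O.X n → Prop

/-- The operadic ideal (that is, the congruence) generated by a family of relations. -/
inductive Operad.Ideal (O : Operad.{u}) (R : O.Relations) : ∀ {n : ℕ}, O.X n → O.X n → Prop
  | of {n : ℕ} {x y : O.X n} : R n x y → O.Ideal R x y
  | refl {n : ℕ} (x : O.X n) : O.Ideal R x x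
  | symm {n : ℕ} {x y : O.X n} : O.Ideal R x y → O.Ideal R y x
  | trans {n : ℕ} {x y z : O.X n} : O.Ideal R x y → O.Ideal R y z → O.Ideal R x z
  | act {n : ℕ} (σ : Equiv.Perm (Fin n)) {x y : O.X n} :
      O.Ideal R x y → O.Ideal R (O.act σ x) (O.act σ y)
  | comp {n m k : ℕ} (h : k + 1 = n + m) (i : Fin n) {x x' : O.X n} {y y' : O.X m} :
      O.Ideal R x x' → O.Ideal R y y' → O.Ideal R (O.comp h i x y) (O.comp h i x' y')

def Operad.idealSetoid (O : Operad.{u}) (R : O.Relations) (n : ℕ) : Setoid (O.X n) where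
  r := O.Ideal R
  iseqv := ⟨.refl, .symm, .trans⟩

/-- The quotient of an operad by the ideal generated by a family of relations. -/
def Operad.quotient (O : Operad.{u}) (R : O.Relations) : Operad.{u} where
  X n := Quotient (O.idealSetoid R n)
  act σ := Quotient.map (O.act σ) fun _ _ h => Operad.Ideal.act σ h
  act_one := by
    rintro n ⟨x⟩
    exact congrArg _ (O.act_one x)
  act_mul := by
    rintro n σ τ ⟨x⟩
    exact congrArg _ (O.act_mul σ τ x)
  one := Quotient.mk _ O.one
  comp h i := Quotient.map₂ (O.comp h i) fun _ _ hx _ _ hy => Operad.Ideal.comp h i hx hy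
  comp_one := by
    rintro n i ⟨x⟩
    exact congrArg _ (O.comp_one i x)
  one_comp := by
    rintro n ⟨x⟩
    exact congrArg _ (O.one_comp x)
  comp_seq := by
    rintro n₁ n₂ n₃ a b k h₁₂ h₂₃ h h' i j ⟨x⟩ ⟨y⟩ ⟨z⟩
    exact congrArg _ (O.comp_seq h₁₂ h₂₃ h h' i j x y z)
  comp_par := by
    rintro n₁ n₂ n₃ a b k h₁₂ h₁₃ h h' i j hij ⟨x⟩ ⟨y⟩ ⟨z⟩
    exact congrArg _ (O.comp_par h₁₂ h₁₃ h h' i j hij x y z)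
  comp_act := by
    rintro n m k h i σ τ ⟨x⟩ ⟨y⟩
    exact congrArg _ (O.comp_act h i σ τ x y)

/-- The projection onto a quotient operad. -/
def Operad.toQuotient (O : Operad.{u}) (R : O.Relations) : O.Hom (O.quotient R) where
  toFun x := Quotient.mk _ x
  map_act _ _ := rfl
  map_one := rfl
  map_comp _ _ _ _ := rfl

/-- The image of a generator in the operad `F(E)/(R)`. -/
def presentedGen {E : SymCollection.{u}} (R : (freeOperad E).Relations) {n : ℕ} (e : E.X n) :
    ((freeOperad E).quotient R).X n :=
  ((freeOperad E).toQuotient R).toFun ((freeGen E).toFun e)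

/-! ### Topological operads -/

/-- The given topologies make the operad a topological operad. -/
structure Operad.IsTopological (O : Operad.{u}) (t : ∀ n : ℕ, TopologicalSpace (O.X n)) :
    Prop where
  continuous_act : ∀ {n : ℕ} (σ : Equiv.Perm (Fin n)), Continuous (O.act σ : O.X n → O.X n)
  continuous_comp : ∀ {n m k : ℕ} (h : k + 1 = n + m) (i : Fin n),
    Continuous fun p : O.X n × O.X m => O.comp h i p.1 p.2

/-- For a collection `E` of spaces, a family of topologies on `F(E)/(R)` that makes it a
topological operad receiving a continuous map from `E`. -/
def IsPresentationTopology {E : SymCollection.{u}} [∀ n, TopologicalSpace (E.X n)]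
    (R : (freeOperad E).Relations)
    (t : ∀ n : ℕ, TopologicalSpace (((freeOperad E).quotient R).X n)) : Prop :=
  ((freeOperad E).quotient R).IsTopological t ∧
    ∀ n : ℕ, @Continuous _ _ _ (t n) (presentedGen R : E.X n → _)

/-- The topology of the topological operad presented by generators `E` and relations `R`:
the finest one that makes `F(E)/(R)` a topological operad receiving a continuous map from `E`. -/
@[reducible] def presentedTopology {E : SymCollection.{u}} [∀ n, TopologicalSpace (E.X n)]
    (R : (freeOperad E).Relations) (n : ℕ) :
    TopologicalSpace (((freeOperad E).quotient R).X n) :=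
  sInf {s | ∃ t, IsPresentationTopology R t ∧ s = t n}

theorem isPresentationTopology_presentedTopology {E : SymCollection.{u}}
    [∀ n, TopologicalSpace (E.X n)] (R : (freeOperad E).Relations) :
    IsPresentationTopology R (presentedTopology R) := by
  refine ⟨⟨fun {n} σ => ?_, fun {n m k} h i => ?_⟩, fun n => ?_⟩
  · refine continuous_sInf_rng.2 ?_
    rintro _ ⟨t, ht, rfl⟩
    exact continuous_sInf_dom ⟨t, ht, rfl⟩ (ht.1.continuous_act σ)
  · refine continuous_sInf_rng.2 ?_
    rintro _ ⟨t, ht, rfl⟩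
    exact continuous_sInf_dom₂ ⟨t, ht, rfl⟩ ⟨t, ht, rfl⟩ (ht.1.continuous_comp h i)
  · refine continuous_sInf_rng.2 ?_
    rintro _ ⟨t, ht, rfl⟩
    exact ht.2 n

/-! ### Binary operations and quadratic relations of an operad -/

/-- The binary operations of an operad, as a symmetric collection concentrated in arity `2`. -/
def Operad.binary (O : Operad.{u}) : SymCollection.{u} where
  X n := {_x : O.X n // n = 2}
  act σ x := ⟨O.act σ x.1, x.2⟩
  act_one x := Subtype.ext (O.act_one x.1)
  act_mul σ τ x := Subtype.ext (O.act_mul σ τ x.1)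

instance (O : Operad.{u}) [∀ n, TopologicalSpace (O.X n)] (n : ℕ) :
    TopologicalSpace (O.binary.X n) :=
  inferInstanceAs (TopologicalSpace {_x : O.X n // n = 2})

def Operad.binaryIncl (O : Operad.{u}) : O.binary.Hom O.toSymCollection where
  toFun x := x.1
  map_act _ _ := rfl

/-- The operad is generated by its binary operations. -/
def Operad.IsBinaryGenerated (O : Operad.{u}) : Prop :=
  ∀ (n : ℕ) (x : O.X n), O.Generated (fun k => {_x : O.X k | k = 2}) x

/-- All relations between binary operations of the operad that involve exactly two operations on
either side: the pairs of elements of weight `2` of the free operad on the binary operations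
that have the same value in the operad. -/
def Operad.quadraticRelations (O : Operad.{u}) : (freeOperad O.binary).Relations :=
  fun _ x y => weight x = 2 ∧ weight y = 2 ∧
    (freeLift O.binaryIncl).toFun x = (freeLift O.binaryIncl).toFun y

/-- The topological operad `O` is presented by its binary operations, subject to the
relations `R`: there is an isomorphism of topological operads from `F(O(2))/(R)` to `O` that
is the identity on the binary operations. -/
def Operad.IsPresentedBy (O : Operad.{u}) [∀ n, TopologicalSpace (O.X n)]
    (R : (freeOperad O.binary).Relations) : Prop :=
  ∃ φ : ((freeOperad O.binary).quotient R).Hom O,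
    (∀ (n : ℕ) (e : O.binary.X n), φ.toFun (presentedGen R e) = e.1) ∧
    ∀ n : ℕ, @IsHomeomorph _ _ (presentedTopology R n) _
      (φ.toFun : ((freeOperad O.binary).quotient R).X n → O.X n)

/-! ### Trees with labelled edges -/

/-- A rooted tree with vertex set `V`. -/
structure RootedTree (V : Type v) where
  graph : SimpleGraph V
  isTree : graph.IsTree
  root : V

/-- A rooted tree with vertex set `V` and edges labelled by elements of `Y`. For a space `Y`, the
topology is that of a disjoint union, over all rooted trees, of products of copies of `Y`. -/
abbrev LabelledTree (Y : Type u) (V : Type v) : Type (max u v) :=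
  Σ T : RootedTree V, (T.graph.edgeSet → Y)

namespace LabelledTree

variable {Y : Type u} {V V' W : Type}

/-- The edge `e` belongs to `T` and is labelled by `y`. -/
def HasEdge (T : LabelledTree Y V) (e : Sym2 V) (y : Y) : Prop :=
  ∃ he : e ∈ T.1.graph.edgeSet, T.2 ⟨e, he⟩ = y

theorem ext' {T T' : LabelledTree Y V} (hr : T.1.root = T'.1.root)
    (he : ∀ e y, T.HasEdge e y ↔ T'.HasEdge e y) : T = T' := by
  obtain ⟨⟨G, hG, r⟩, l⟩ := T
  obtain ⟨⟨G', hG', r'⟩, l'⟩ := T'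
  have hGG : G = G' := by
    rw [← SimpleGraph.edgeSet_inj]
    ext e
    exact ⟨fun h => ((he e _).1 ⟨h, rfl⟩).1, fun h => ((he e _).2 ⟨h, rfl⟩).1⟩
  subst hGG
  obtain rfl : r = r' := hr
  obtain rfl : l = l' := by
    ext ⟨e, h⟩
    obtain ⟨_, h'⟩ := (he e _).1 ⟨h, rfl⟩
    exact h'.symm
  rfl

/-- Renaming the vertices of a tree. -/
def relabel (σ : V ≃ W) (T : LabelledTree Y V) : LabelledTree Y W :=
  ⟨⟨T.1.graph.map σ, (SimpleGraph.Iso.map σ T.1.graph).isTree_iff.1 T.1.isTree, σ T.1.root⟩,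
    T.2 ∘ (SimpleGraph.Iso.map σ T.1.graph).mapEdgeSet.symm⟩

theorem hasEdge_relabel (σ : V ≃ W) (T : LabelledTree Y V) (e : Sym2 W) (y : Y) :
    (T.relabel σ).HasEdge e y ↔ ∃ e', T.HasEdge e' y ∧ Sym2.map σ e' = e := by
  constructor
  · rintro ⟨h, hy⟩
    obtain ⟨⟨e', he'⟩, hee⟩ := (SimpleGraph.Iso.map σ T.1.graph).mapEdgeSet.surjective ⟨e, h⟩
    refine ⟨e', ⟨he', ?_⟩, congrArg Subtype.val hee⟩
    rw [← hy]
    simp only [relabel, Function.comp_apply]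
    rw [← hee, Equiv.symm_apply_apply]
  · rintro ⟨e', ⟨he', hy⟩, rfl⟩
    refine ⟨((SimpleGraph.Iso.map σ T.1.graph).mapEdgeSet ⟨e', he'⟩).2, ?_⟩
    rw [← hy]
    exact congrArg T.2 ((SimpleGraph.Iso.map σ T.1.graph).mapEdgeSet.symm_apply_apply ⟨e', he'⟩)

end LabelledTree

/-- Data for gluing two sets of vertices along one point: `W` is the union of the images of `V`
and `V'`, and these images meet in the single point `f i = g r`. -/
structure Gluing {V V' W : Type} (f : V ↪ W) (g : V' ↪ W) (i : V) (r : V') : Prop where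
  glue : f i = g r
  eq_of_eq : ∀ a b, f a = g b → a = i
  cover : ∀ w, (∃ a, f a = w) ∨ ∃ b, g b = w

namespace Gluing

variable {V V' W : Type} {f : V ↪ W} {g : V' ↪ W} {i : V} {r : V'}

theorem edge_bijective (H : Gluing f g i r) (G : SimpleGraph V) (G' : SimpleGraph V') :
    Function.Bijective (Sum.elim
      (fun e : G.edgeSet => (⟨Sym2.map f e.1, by
        have : f.sym2Map e.1 ∈ (G.map f).edgeSet := by
          rw [SimpleGraph.edgeSet_map]; exact ⟨e.1, e.2, rfl⟩
        rw [SimpleGraph.edgeSet_sup]; exact Or.inl this⟩ : (G.map f ⊔ G'.map g).edgeSet))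
      (fun e : G'.edgeSet => (⟨Sym2.map g e.1, by
        have : g.sym2Map e.1 ∈ (G'.map g).edgeSet := by
          rw [SimpleGraph.edgeSet_map]; exact ⟨e.1, e.2, rfl⟩
        rw [SimpleGraph.edgeSet_sup]; exact Or.inr this⟩ : (G.map f ⊔ G'.map g).edgeSet))) := by
  have key : ∀ (e : Sym2 V) (e' : Sym2 V'), e ∈ G.edgeSet → Sym2.map f e ≠ Sym2.map g e' := by
    intro e e' he hee
    induction e with | _ a b
    induction e' with | _ c d
    have hab : a ≠ b := G.ne_of_adj he
    simp only [Sym2.map_mk, Sym2.eq_iff] at hee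
    rcases hee with ⟨h1, h2⟩ | ⟨h1, h2⟩ <;>
      exact hab ((H.eq_of_eq _ _ h1).trans (H.eq_of_eq _ _ h2).symm)
  constructor
  · rintro (⟨a, ha⟩ | ⟨a, ha⟩) (⟨b, hb⟩ | ⟨b, hb⟩) hab <;>
      simp only [Sum.elim_inl, Sum.elim_inr, Subtype.mk.injEq] at hab
    · simpa using Sym2.map.injective f.injective hab
    · exact (key _ _ ha hab).elim
    · exact (key _ _ hb hab.symm).elim
    · simpa using Sym2.map.injective g.injective hab
  · rintro ⟨e, he⟩
    have he' := he
    rw [SimpleGraph.edgeSet_sup, SimpleGraph.edgeSet_map, SimpleGraph.edgeSet_map] at he'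
    rcases he' with ⟨a, ha, rfl⟩ | ⟨a, ha, rfl⟩
    · exact ⟨Sum.inl ⟨a, ha⟩, rfl⟩
    · exact ⟨Sum.inr ⟨a, ha⟩, rfl⟩

/-- The edge set of the glued graph is the disjoint union of the two edge sets. -/
noncomputable def edgeEquiv (H : Gluing f g i r) (G : SimpleGraph V) (G' : SimpleGraph V') :
    G.edgeSet ⊕ G'.edgeSet ≃ (G.map f ⊔ G'.map g).edgeSet :=
  Equiv.ofBijective _ (H.edge_bijective G G')

theorem isTree [Finite V] [Finite V'] [Finite W] (H : Gluing f g i r) {G : SimpleGraph V}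
    {G' : SimpleGraph V'} (hG : G.IsTree) (hG' : G'.IsTree)
    (hcard : Nat.card W + 1 = Nat.card V + Nat.card V') : (G.map f ⊔ G'.map g).IsTree := by
  rw [SimpleGraph.isTree_iff_connected_and_card] at hG hG' ⊢
  refine ⟨?_, ?_⟩
  · let F : G →g (G.map f ⊔ G'.map g) :=
      (SimpleGraph.Hom.ofLE le_sup_left).comp (SimpleGraph.Embedding.map f G).toHom
    let F' : G' →g (G.map f ⊔ G'.map g) :=
      (SimpleGraph.Hom.ofLE le_sup_right).comp (SimpleGraph.Embedding.map g G').toHom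
    have hreach : ∀ w, (G.map f ⊔ G'.map g).Reachable (f i) w := by
      intro w
      rcases H.cover w with ⟨a, rfl⟩ | ⟨b, rfl⟩
      · exact (hG.1.preconnected i a).map F
      · rw [H.glue]
        exact (hG'.1.preconnected r b).map F'
    have : Nonempty W := ⟨f i⟩
    exact ⟨fun a b => (hreach a).symm.trans (hreach b)⟩
  · rw [← Nat.card_congr (H.edgeEquiv G G'), Nat.card_sum]
    omega

end Gluing

namespace LabelledTree

variable {Y : Type u} {V V' W : Type}

/-- Gluing the root of `T'` to the vertex `i` of `T`; the root is that of `T`, and all edges keep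
their labels. -/
noncomputable def glue [Finite V] [Finite V'] [Finite W] {f : V ↪ W} {g : V' ↪ W} {i : V}
    (T : LabelledTree Y V) (T' : LabelledTree Y V') (H : Gluing f g i T'.1.root)
    (hcard : Nat.card W + 1 = Nat.card V + Nat.card V') : LabelledTree Y W :=
  ⟨⟨T.1.graph.map f ⊔ T'.1.graph.map g, H.isTree T.1.isTree T'.1.isTree hcard, f T.1.root⟩,
    Sum.elim T.2 T'.2 ∘ (H.edgeEquiv T.1.graph T'.1.graph).symm⟩

theorem hasEdge_glue [Finite V] [Finite V'] [Finite W] {f : V ↪ W} {g : V' ↪ W} {i : V}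
    (T : LabelledTree Y V) (T' : LabelledTree Y V') (H : Gluing f g i T'.1.root)
    (hcard : Nat.card W + 1 = Nat.card V + Nat.card V') (e : Sym2 W) (y : Y) :
    (T.glue T' H hcard).HasEdge e y ↔
      (∃ e', T.HasEdge e' y ∧ Sym2.map f e' = e) ∨ ∃ e', T'.HasEdge e' y ∧ Sym2.map g e' = e := by
  constructor
  · rintro ⟨h, hy⟩
    obtain ⟨e', hee⟩ := (H.edgeEquiv T.1.graph T'.1.graph).surjective ⟨e, h⟩
    have hy' : Sum.elim T.2 T'.2 e' = y := by
      rw [← hy]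
      simp only [glue, Function.comp_apply]
      rw [← hee, Equiv.symm_apply_apply]
    rcases e' with ⟨e', he'⟩ | ⟨e', he'⟩
    · exact Or.inl ⟨e', ⟨he', hy'⟩, congrArg Subtype.val hee⟩
    · exact Or.inr ⟨e', ⟨he', hy'⟩, congrArg Subtype.val hee⟩
  · rintro (⟨e', ⟨he', hy⟩, rfl⟩ | ⟨e', ⟨he', hy⟩, rfl⟩)
    · refine ⟨(H.edgeEquiv T.1.graph T'.1.graph (Sum.inl ⟨e', he'⟩)).2, ?_⟩
      rw [← hy]
      exact congrArg (Sum.elim T.2 T'.2)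
        ((H.edgeEquiv T.1.graph T'.1.graph).symm_apply_apply (Sum.inl ⟨e', he'⟩))
    · refine ⟨(H.edgeEquiv T.1.graph T'.1.graph (Sum.inr ⟨e', he'⟩)).2, ?_⟩
      rw [← hy]
      exact congrArg (Sum.elim T.2 T'.2)
        ((H.edgeEquiv T.1.graph T'.1.graph).symm_apply_apply (Sum.inr ⟨e', he'⟩))

end LabelledTree

/-! ### The operad of labelled trees -/

/-- The vertices of a composite tree that come from the inner tree. -/
def innerVertex {n m k : ℕ} (h : k + 1 = n + m) (i : Fin n) : Fin m ↪ Fin k where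
  toFun := inner h i
  inj' a b hab := by
    have := congrArg Fin.val hab
    simp only [inner] at this
    exact Fin.ext (by omega)

theorem outerVertex_injective {n m k : ℕ} (h : k + 1 = n + m) (i : Fin n) (r : Fin m) :
    Function.Injective fun j : Fin n => if hj : j = i then inner h i r else outer h i ⟨j, hj⟩ := by
  intro a b hab
  have H := (bijective_outer_inner h i).1
  simp only at hab
  split_ifs at hab with ha hb hb
  · rw [ha, hb]
  · exact absurd (@H (Sum.inr r) (Sum.inl ⟨b, hb⟩) hab) (by simp)
  · exact absurd (@H (Sum.inl ⟨a, ha⟩) (Sum.inr r) hab) (by simp)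
  · simpa using @H (Sum.inl ⟨a, ha⟩) (Sum.inl ⟨b, hb⟩) hab

/-- The vertices of a composite tree that come from the outer tree; the vertex `i` becomes the
root `r` of the inner tree. -/
def outerVertex {n m k : ℕ} (h : k + 1 = n + m) (i : Fin n) (r : Fin m) : Fin n ↪ Fin k where
  toFun j := if hj : j = i then inner h i r else outer h i ⟨j, hj⟩
  inj' := outerVertex_injective h i r

theorem gluing_vertex {n m k : ℕ} (h : k + 1 = n + m) (i : Fin n) (r : Fin m) :
    Gluing (outerVertex h i r) (innerVertex h i) i r where
  glue := by
    simp only [outerVertex, innerVertex, Function.Embedding.coeFn_mk, dite_true]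
    rfl
  eq_of_eq a b hab := by
    by_contra ha
    have H := (bijective_outer_inner h i).1
    simp only [outerVertex, innerVertex, Function.Embedding.coeFn_mk, ha, dite_false] at hab
    exact absurd (@H (Sum.inl ⟨a, ha⟩) (Sum.inr b) hab) (by simp)
  cover w := by
    obtain ⟨⟨j, hj⟩ | j, hw⟩ := (bijective_outer_inner h i).2 w
    · exact Or.inl ⟨j, by simpa [outerVertex, hj] using hw⟩
    · exact Or.inr ⟨j, hw⟩

theorem innerVertex_val {n m k : ℕ} (h : k + 1 = n + m) (i : Fin n) (j : Fin m) :
    (innerVertex h i j).1 = i.1 + j.1 := rfl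

theorem outerVertex_val {n m k : ℕ} (h : k + 1 = n + m) (i : Fin n) (r : Fin m) (j : Fin n) :
    (outerVertex h i r j).1 =
      if j.1 < i.1 then j.1 else if j.1 = i.1 then i.1 + r.1 else j.1 + m - 1 := by
  simp only [outerVertex, Function.Embedding.coeFn_mk, outer, inner, Fin.ext_iff]
  split_ifs <;> simp_all

/-- The composite `T ∘ᵢ T'`: the root of `T'` is identified with the vertex `i` of `T`. -/
noncomputable def treeComp {Y : Type u} {n m k : ℕ} (h : k + 1 = n + m) (i : Fin n)
    (T : LabelledTree Y (Fin n)) (T' : LabelledTree Y (Fin m)) : LabelledTree Y (Fin k) :=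
  T.glue T' (gluing_vertex h i T'.1.root) (by simpa using h)

theorem treeComp_root {Y : Type u} {n m k : ℕ} (h : k + 1 = n + m) (i : Fin n)
    (T : LabelledTree Y (Fin n)) (T' : LabelledTree Y (Fin m)) :
    (treeComp h i T T').1.root = outerVertex h i T'.1.root T.1.root := rfl

theorem hasEdge_treeComp {Y : Type u} {n m k : ℕ} (h : k + 1 = n + m) (i : Fin n)
    (T : LabelledTree Y (Fin n)) (T' : LabelledTree Y (Fin m)) (e : Sym2 (Fin k)) (y : Y) :
    (treeComp h i T T').HasEdge e y ↔
      (∃ e', T.HasEdge e' y ∧ Sym2.map (outerVertex h i T'.1.root) e' = e) ∨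
        ∃ e', T'.HasEdge e' y ∧ Sym2.map (innerVertex h i) e' = e :=
  LabelledTree.hasEdge_glue ..

/-- The tree with a single vertex. -/
def pointTree (Y : Type u) : LabelledTree Y (Fin 1) :=
  ⟨⟨⊥, SimpleGraph.IsTree.of_subsingleton, 0⟩, fun e => absurd e.2 (by simp)⟩

theorem not_hasEdge_pointTree {Y : Type u} (e : Sym2 (Fin 1)) (y : Y) :
    ¬ (pointTree Y).HasEdge e y := by
  rintro ⟨h, -⟩
  simp [pointTree] at h

theorem exists_edge_map {A B C : Type} {P : Sym2 A → Prop} {f : A → B} {g : B → C}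
    {e : Sym2 C} :
    (∃ b, (∃ a, P a ∧ Sym2.map f a = b) ∧ Sym2.map g b = e) ↔
      ∃ a, P a ∧ Sym2.map (g ∘ f) a = e := by
  constructor
  · rintro ⟨_, ⟨a, ha, rfl⟩, rfl⟩
    exact ⟨a, ha, by rw [Sym2.map_map]⟩
  · rintro ⟨a, ha, rfl⟩
    exact ⟨_, ⟨a, ha, rfl⟩, by rw [Sym2.map_map]⟩

theorem or_exists_edge {A A' B C : Type} {P : Sym2 A → Prop} {P' : Sym2 A' → Prop} {f : A → B}
    {f' : A' → B} {g : B → C} {e : Sym2 C} :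
    (∃ b, ((∃ a, P a ∧ Sym2.map f a = b) ∨ ∃ a, P' a ∧ Sym2.map f' a = b) ∧ Sym2.map g b = e) ↔
      (∃ a, P a ∧ Sym2.map (g ∘ f) a = e) ∨ ∃ a, P' a ∧ Sym2.map (g ∘ f') a = e := by
  rw [← exists_edge_map, ← exists_edge_map, ← exists_or]
  simp only [or_and_right]

theorem exists_edge_congr {A C : Type} {P : Sym2 A → Prop} {f g : A → C} {e : Sym2 C}
    (h : ∀ a, f a = g a) :
    (∃ a, P a ∧ Sym2.map f a = e) ↔ ∃ a, P a ∧ Sym2.map g a = e := by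
  rw [funext h]

theorem isTree_top_fin_two : (⊤ : SimpleGraph (Fin 2)).IsTree := by
  rw [SimpleGraph.isTree_iff_connected_and_card]
  refine ⟨SimpleGraph.connected_top, ?_⟩
  rw [Nat.card_eq_fintype_card, ← SimpleGraph.edgeFinset_card,
    SimpleGraph.card_edgeFinset_top_eq_card_choose_two]
  simp

/-- The operad `NAP_Y`: its elements of arity `n` are the trees on the vertices `0, …, n - 1`
with edges labelled by `Y`. -/
noncomputable def NAP (Y : Type u) : Operad.{u} where
  X n := LabelledTree Y (Fin n)
  act σ T := T.relabel σ
  act_one T := by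
    refine LabelledTree.ext' rfl fun e y => ?_
    simp [LabelledTree.hasEdge_relabel]
  act_mul σ τ T := by
    refine LabelledTree.ext' rfl fun e y => ?_
    simp [LabelledTree.hasEdge_relabel, Sym2.map_map]
  one := pointTree Y
  comp := treeComp
  comp_one i T := by
    have hv : ∀ j, outerVertex (m := 1) rfl i (pointTree Y).1.root j = j := fun j => by
      ext
      simp only [outerVertex_val, Fin.val_eq_zero]
      split_ifs <;> omega
    have hm : ⇑(outerVertex (m := 1) rfl i (pointTree Y).1.root) = id := funext hv
    refine LabelledTree.ext' (by rw [treeComp_root, hv]) fun e y => ?_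
    simp [hasEdge_treeComp, not_hasEdge_pointTree, hm]
  one_comp {n} T := by
    have hv : ∀ j, innerVertex (Nat.add_comm n 1) 0 j = j := fun j => by
      ext
      simp [innerVertex_val]
    have hm : ⇑(innerVertex (Nat.add_comm n 1) 0) = id := funext hv
    refine LabelledTree.ext' ?_ fun e y => ?_
    · rw [treeComp_root]
      ext
      simp [outerVertex_val, pointTree]
    · simp [hasEdge_treeComp, not_hasEdge_pointTree, hm]
  comp_seq h₁₂ h₂₃ h h' i j x y z := by
    refine LabelledTree.ext' ?_ fun e c => ?_
    · simp only [treeComp_root]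
      ext
      simp only [outerVertex_val]
      split_ifs <;> omega
    · simp only [hasEdge_treeComp]
      rw [or_exists_edge, or_exists_edge, or_assoc]
      refine or_congr ?_ (or_congr ?_ ?_)
      · refine exists_edge_congr fun v => ?_
        simp only [Function.comp_apply, treeComp_root]
        ext
        simp only [outerVertex_val]
        grind
      · refine exists_edge_congr fun v => ?_
        simp only [Function.comp_apply]
        ext
        simp only [outerVertex_val, innerVertex_val]
        grind
      · refine exists_edge_congr fun v => ?_
        simp only [Function.comp_apply]
        ext
        simp only [innerVertex_val]
        omega
  comp_par h₁₂ h₁₃ h h' i j hij x y z := by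
    refine LabelledTree.ext' ?_ fun e c => ?_
    · simp only [treeComp_root]
      ext
      simp only [outerVertex_val]
      split_ifs <;> omega
    · simp only [hasEdge_treeComp]
      rw [or_exists_edge, or_exists_edge, or_assoc, or_assoc]
      refine or_congr ?_ (or_comm.trans (or_congr ?_ ?_))
      · refine exists_edge_congr fun v => ?_
        simp only [Function.comp_apply]
        ext
        simp only [outerVertex_val]
        grind
      · refine exists_edge_congr fun v => ?_
        simp only [Function.comp_apply]
        ext
        simp only [outerVertex_val, innerVertex_val]
        grind
      · refine exists_edge_congr fun v => ?_
        simp only [Function.comp_apply]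
        ext
        simp only [outerVertex_val, innerVertex_val]
        grind
  comp_act h i σ τ x y := by
    have hin : ∀ v, innerVertex h (σ i) (τ v) = blockPerm h i σ τ (innerVertex h i v) := fun v =>
      (blockPerm_inner h i σ τ v).symm
    have hout : ∀ r v, outerVertex h (σ i) (τ r) (σ v) =
        blockPerm h i σ τ (outerVertex h i r v) := fun r v => by
      by_cases hv : v = i
      · subst hv
        simpa [outerVertex] using (blockPerm_inner h v σ τ r).symm
      · simpa [outerVertex, hv] using (blockPerm_outer h i σ τ ⟨v, hv⟩).symm
    refine LabelledTree.ext' (hout _ _) fun e c => ?_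
    rw [hasEdge_treeComp, LabelledTree.hasEdge_relabel]
    simp only [LabelledTree.hasEdge_relabel, hasEdge_treeComp]
    rw [exists_edge_map, exists_edge_map, or_exists_edge]
    exact or_congr (exists_edge_congr (hout _)) (exists_edge_congr hin)

instance {Y : Type u} [TopologicalSpace Y] (n : ℕ) : TopologicalSpace ((NAP Y).X n) :=
  inferInstanceAs (TopologicalSpace (LabelledTree Y (Fin n)))

/-- The binary operation of `NAP_Y` given by the tree with root `0`, second vertex `1`, and edge
labelled by `y`. -/
def edgeTree {Y : Type u} (y : Y) : LabelledTree Y (Fin 2) :=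
  ⟨⟨⊤, isTree_top_fin_two, 0⟩, fun _ => y⟩

/-- The binary operation `edgeTree y` as a generator of the free operad. -/
noncomputable def edgeGen {Y : Type u} (y : Y) : (freeOperad (NAP Y).binary).X 2 :=
  (freeGen (NAP Y).binary).toFun ⟨edgeTree y, rfl⟩

/-- For all `y, z` in `Y`, the relation `μ_y ∘₁ μ_z = (μ_z ∘₁ μ_y).(2 3)` between the operations
`μ_y = edgeTree y`; with inputs numbered from `0` this reads
`μ_y ∘₀ μ_z = (μ_z ∘₀ μ_y).(1 2)`. -/
inductive napRelations (Y : Type u) : (freeOperad (NAP Y).binary).Relations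
  | rel (y z : Y) : napRelations Y 3
      ((freeOperad (NAP Y).binary).comp (n := 2) (m := 2) rfl 0 (edgeGen y) (edgeGen z))
      ((freeOperad (NAP Y).binary).act (Equiv.swap 1 2)
        ((freeOperad (NAP Y).binary).comp (n := 2) (m := 2) rfl 0 (edgeGen z) (edgeGen y)))

end TreeOperad

namespace TreeOperad

universe u v

/-! ### Grafting a leaf at the last input -/

/-! Every rooted tree with at least two vertices has a leaf other than its root, so it arises by
attaching a leaf to a smaller tree. Attaching a leaf is composition with a binary operation
`edgeTree y` followed by a renumbering. Hence trees are exactly the iterated grafts of the `edgeTree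
y`, up to permutation of the vertices; this gives binary generation and, for any operad over `NAP Y`
whose operations lift the edge trees, surjectivity (`exists_map_eq`).

For injectivity, let an operad contain operations `μ y` lying over the edge trees and satisfying `μ
y ∘₀ μ z = (μ z ∘₀ μ y).(1 2)`. Two successive grafts can then be exchanged, up to swapping the two
new inputs (`graft_graft`): at different inputs by the parallel axiom, at the same input by the
sequential axiom and the relation. Therefore any leaf of the underlying tree can be made the one
grafted last (`exists_eq_act_graft_of_isLeaf`). If two iterated grafts have the same tree, a common
leaf is brought to the last place in both; the tree determines where it is attached and its label,
so it can be removed, and induction on the arity shows that the operations agree (`eq_of_map_eq`).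

In a presented operad every element is an iterated graft, since these are closed under permutation
and composition (`comp_mem_graftClosure`). So the morphism to `NAP Y` is bijective for any relations
that hold in `NAP Y` and imply the displayed ones; both families of relations qualify.

For the topology, the morphism is continuous because the topologies pulled back from `NAP Y` compete
in the definition of the presented topology. Its inverse is continuous on each piece `Y^{E(T)}`: the
leaf to be removed depends only on the shape `T`, so the inverse is a fixed expression in continuous
operations applied to coordinates, by induction on the arity. -/

/-- The extension of a permutation of `Fin n` to `Fin (n + 1)` that fixes the last element. -/
def extendLast {n : ℕ} (σ : Equiv.Perm (Fin n)) : Equiv.Perm (Fin (n + 1)) :=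
  finSuccEquivLast.trans (σ.optionCongr.trans finSuccEquivLast.symm)

@[simp] theorem extendLast_castSucc {n : ℕ} (σ : Equiv.Perm (Fin n)) (j : Fin n) :
    extendLast σ j.castSucc = (σ j).castSucc := by
  simp [extendLast]

@[simp] theorem extendLast_last {n : ℕ} (σ : Equiv.Perm (Fin n)) :
    extendLast σ (Fin.last n) = Fin.last n := by
  simp [extendLast]

/-- This identifies the stabiliser of the last element. Two numberings of a tree with the same last
leaf differ by such a permutation, so that the difference can be absorbed into the smaller tree. -/
theorem exists_extendLast_eq {n : ℕ} (σ : Equiv.Perm (Fin (n + 1)))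
    (h : σ (Fin.last n) = Fin.last n) : ∃ τ, extendLast τ = σ := by
  have key : ∀ ρ : Equiv.Perm (Fin (n + 1)), ρ (Fin.last n) = Fin.last n →
      ∀ j : Fin n, ρ j.castSucc ≠ Fin.last n := fun ρ hρ j hj =>
    (Fin.castSucc_lt_last j).ne (ρ.injective (hj.trans hρ.symm))
  have h' : σ.symm (Fin.last n) = Fin.last n := by rw [Equiv.symm_apply_eq, h]
  refine ⟨⟨fun j => (σ j.castSucc).castPred (key σ h j),
    fun j => (σ.symm j.castSucc).castPred (key σ.symm h' j), fun j => ?_, fun j => ?_⟩, ?_⟩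
  · simp
  · simp
  · ext j
    induction j using Fin.lastCases with
    | last => simp [h]
    | cast j => simp

/-- The permutation that moves the element `p + 1` to the last place and keeps the order of the
others. -/
def moveLast {n : ℕ} (p : Fin n) : Equiv.Perm (Fin (n + 1)) :=
  (finSuccEquiv' p.succ).trans finSuccEquivLast.symm

@[simp] theorem moveLast_succ {n : ℕ} (p : Fin n) : moveLast p p.succ = Fin.last n := by
  simp [moveLast]

@[simp] theorem moveLast_succAbove {n : ℕ} (p j : Fin n) :
    moveLast p (p.succ.succAbove j) = j.castSucc := by
  simp [moveLast]

theorem moveLast_val {n : ℕ} (p : Fin n) (j : Fin (n + 1)) :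
    (moveLast p j).1 = if j.1 ≤ p.1 then j.1 else if j.1 = p.1 + 1 then n else j.1 - 1 := by
  by_cases hj : j = p.succ
  · subst hj
    simp
  · obtain ⟨i, rfl⟩ := Fin.exists_succAbove_eq hj
    rw [moveLast_succAbove]
    simp only [Fin.succAbove, Fin.lt_def, Fin.val_castSucc, Fin.val_succ]
    split_ifs <;> simp_all <;> omega

theorem extendLast_val {n : ℕ} (σ : Equiv.Perm (Fin n)) (j : Fin (n + 1)) :
    (extendLast σ j).1 = if h : j.1 < n then (σ ⟨j.1, h⟩).1 else n := by
  induction j using Fin.lastCases with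
  | last => simp
  | cast j => simp

/-! ### Renumberings attached to the insertion of binary operations -/

theorem inner_zero_two {n : ℕ} (p : Fin n) :
    inner (n := n) (m := 2) (k := n + 1) rfl p 0 = p.castSucc := by
  ext; simp [inner]

theorem inner_one_two {n : ℕ} (p : Fin n) :
    inner (n := n) (m := 2) (k := n + 1) rfl p 1 = p.succ := by
  ext; simp [inner]

theorem outer_two {n : ℕ} (p : Fin n) (j : {j : Fin n // j ≠ p}) :
    outer (n := n) (m := 2) (k := n + 1) rfl p j = p.succ.succAbove j.1 := by
  have := Fin.val_ne_of_ne j.2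
  ext
  simp only [outer, Fin.succAbove, Fin.lt_def, Fin.val_castSucc, Fin.val_succ]
  split_ifs <;> simp <;> omega

theorem succ_succAbove_self {n : ℕ} (p : Fin n) : p.succ.succAbove p = p.castSucc := by
  simp

/-- Both sides send the new input `p + 1` to the last place and act as `σ` on the old inputs. This
is the permutation identity behind `graft_act`. -/
theorem moveLast_mul_blockPerm {n : ℕ} (p : Fin n) (σ : Equiv.Perm (Fin n)) :
    moveLast (σ p) * blockPerm (n := n) (m := 2) (k := n + 1) rfl p σ 1 = extendLast σ * moveLast p := by
  ext1 j
  by_cases hj : j = p.succ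
  · subst hj
    have := blockPerm_inner (n := n) (m := 2) (k := n + 1) rfl p σ 1 1
    rw [Equiv.Perm.one_apply, inner_one_two, inner_one_two] at this
    simp [this]
  · obtain ⟨i, rfl⟩ := Fin.exists_succAbove_eq hj
    have : blockPerm (n := n) (m := 2) (k := n + 1) rfl p σ 1 (p.succ.succAbove i) =
        (σ p).succ.succAbove (σ i) := by
      by_cases hi : i = p
      · subst hi
        have := blockPerm_inner (n := n) (m := 2) (k := n + 1) rfl i σ 1 0
        rw [Equiv.Perm.one_apply, inner_zero_two, inner_zero_two] at this
        simpa using this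
      · have := blockPerm_outer (n := n) (m := 2) (k := n + 1) rfl p σ 1 ⟨i, hi⟩
        rwa [outer_two, outer_two] at this
    simp [this]

theorem succ_succAbove_of_lt {n : ℕ} {p q : Fin n} (h : p < q) :
    p.succ.succAbove q = q.succ := by
  rw [Fin.succAbove_of_le_castSucc]
  exact h

theorem succ_succAbove_of_gt {n : ℕ} {p q : Fin n} (h : p < q) :
    q.succ.succAbove p = p.castSucc := by
  rw [Fin.succAbove_of_castSucc_lt]
  exact lt_trans h (Fin.castSucc_lt_succ)

theorem extendLast_mul_moveLast_of_lt {n : ℕ} {p q : Fin n} (h : p < q) :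
    extendLast (moveLast p) * moveLast (p.succ.succAbove q) =
      Equiv.swap (Fin.last (n + 1)) (Fin.last n).castSucc *
        (extendLast (moveLast q) * moveLast (q.succ.succAbove p)) := by
  rw [succ_succAbove_of_lt h, succ_succAbove_of_gt h]
  ext j
  have := j.2
  have := p.2
  have := q.2
  rw [Fin.lt_def] at h
  simp only [Equiv.Perm.mul_apply, extendLast_val, moveLast_val, Equiv.swap_apply_def,
    Fin.ext_iff, apply_ite Fin.val, Fin.val_succ, Fin.val_castSucc, Fin.val_last]
  grind

theorem blockPerm_swap {n : ℕ} (p : Fin n) :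
    blockPerm (n := n) (m := 3) (k := n + 2) rfl p 1 (Equiv.swap 1 2) =
      Equiv.swap p.castSucc.succ p.succ.succ := by
  ext1 j
  obtain ⟨j | j, rfl⟩ := (inputEquiv (n := n) (m := 3) (k := n + 2) rfl p).surjective j
  · have hj := Fin.val_ne_of_ne j.2
    refine (blockPerm_outer (n := n) (m := 3) (k := n + 2) rfl p 1 _ j).trans ?_
    change outer (n := n) (m := 3) (k := n + 2) rfl p j =
      Equiv.swap _ _ (outer (n := n) (m := 3) (k := n + 2) rfl p j)
    rw [Equiv.swap_apply_of_ne_of_ne] <;>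
    · simp only [ne_eq, Fin.ext_iff, outer, apply_dite Fin.val, Fin.val_succ, Fin.val_castSucc]
      split_ifs <;> omega
  · refine (blockPerm_inner (n := n) (m := 3) (k := n + 2) rfl p 1 _ j).trans ?_
    change inner (n := n) (m := 3) (k := n + 2) rfl p _ =
      Equiv.swap _ _ (inner (n := n) (m := 3) (k := n + 2) rfl p j)
    ext
    fin_cases j <;> simp [inner, Equiv.swap_apply_def, Fin.ext_iff]
    split_ifs <;> first | omega | rfl

/-- Inside the composite, the inner swap exchanges the positions `p + 1` and `p + 2`. The
renumbering sends these to the last and the last but one place, and conjugating a transposition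
transports its two points. -/
theorem extendLast_mul_moveLast_self {n : ℕ} (p : Fin n) :
    extendLast (moveLast p) * moveLast p.castSucc *
        blockPerm (n := n) (m := 3) (k := n + 2) rfl p 1 (Equiv.swap 1 2) =
      Equiv.swap (Fin.last (n + 1)) (Fin.last n).castSucc *
        (extendLast (moveLast p) * moveLast p.castSucc) := by
  have h : p.succ.succ = p.castSucc.succ.succAbove p.succ :=
    (succ_succAbove_of_lt (p := p.castSucc) (q := p.succ) Fin.castSucc_lt_succ).symm
  rw [blockPerm_swap, Equiv.mul_swap_eq_swap_mul, Equiv.Perm.mul_apply, Equiv.Perm.mul_apply,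
    moveLast_succ, extendLast_last, h, moveLast_succAbove, extendLast_castSucc, moveLast_succ]

/-! ### Exchange of grafts in an arbitrary operad -/

namespace Operad

variable (O : Operad.{u})

theorem act_injective {n : ℕ} (σ : Equiv.Perm (Fin n)) :
    Function.Injective (O.act σ : O.X n → O.X n) := fun x y h => by
  rw [← O.act_one x, ← O.act_one y, ← inv_mul_cancel σ, O.act_mul, O.act_mul, h]

/-- Insertion of a binary operation at the input `p`, with the new input numbered last. -/
def graft {n : ℕ} (p : Fin n) (x : O.X n) (m : O.X 2) : O.X (n + 1) :=
  O.act (moveLast p) (O.comp (n := n) (m := 2) rfl p x m)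

theorem comp_eq_act_graft {n : ℕ} (p : Fin n) (x : O.X n) (m : O.X 2) :
    O.comp (n := n) (m := 2) (k := n + 1) rfl p x m = O.act (moveLast p)⁻¹ (O.graft p x m) := by
  rw [graft, ← O.act_mul, inv_mul_cancel, O.act_one]

/-- Since the new input is numbered last, permutations of the old inputs pass through a graft
without shifts. This is the gain from using `graft` rather than bare partial composition. -/
theorem graft_act {n : ℕ} (σ : Equiv.Perm (Fin n)) (p : Fin n) (x : O.X n) (m : O.X 2) :
    O.graft (σ p) (O.act σ x) m = O.act (extendLast σ) (O.graft p x m) := by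
  have := O.comp_act (n := n) (m := 2) (k := n + 1) rfl p σ 1 x m
  rw [O.act_one] at this
  rw [graft, this, graft, ← O.act_mul, ← O.act_mul, moveLast_mul_blockPerm]

theorem graft_graft_eq {n : ℕ} (p q : Fin n) (x : O.X n) (m m' : O.X 2) :
    O.graft q.castSucc (O.graft p x m) m' =
      O.act (extendLast (moveLast p) * moveLast (p.succ.succAbove q))
        (O.comp (n := n + 1) (m := 2) rfl (p.succ.succAbove q)
          (O.comp (n := n) (m := 2) rfl p x m) m') := by
  conv_lhs => rw [graft.eq_1 O p, ← moveLast_succAbove p q, graft_act, graft, ← O.act_mul]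

theorem graft_graft_of_lt {n : ℕ} {p q : Fin n} (h : p < q) (x : O.X n) (m m' : O.X 2) :
    O.graft q.castSucc (O.graft p x m) m' =
      O.act (Equiv.swap (Fin.last (n + 1)) (Fin.last n).castSucc)
        (O.graft p.castSucc (O.graft q x m') m) := by
  rw [graft_graft_eq, graft_graft_eq, ← O.act_mul, ← extendLast_mul_moveLast_of_lt h]
  congr 1
  rw [succ_succAbove_of_lt h, succ_succAbove_of_gt h]
  exact (O.comp_par (n₁ := n) (n₂ := 2) (n₃ := 2) (a := n + 1) (b := n + 1) (k := n + 2)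
    rfl rfl rfl rfl p q h x m' m).symm

/-- The binary operations `m` and `m'` satisfy `m ∘₀ m' = (m' ∘₀ m).(1 2)`. -/
def GraftCommute (m m' : O.X 2) : Prop :=
  O.comp (n := 2) (m := 2) (k := 3) rfl 0 m m' =
    O.act (Equiv.swap 1 2) (O.comp (n := 2) (m := 2) (k := 3) rfl 0 m' m)

variable {O}

/-- By the sequential axiom, two insertions at the same input amount to one insertion of `m ∘₀ m'`,
to which the relation applies. -/
theorem graft_graft_self {n : ℕ} (p : Fin n) (x : O.X n) {m m' : O.X 2}
    (h : O.GraftCommute m m') :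
    O.graft p.castSucc (O.graft p x m) m' =
      O.act (Equiv.swap (Fin.last (n + 1)) (Fin.last n).castSucc)
        (O.graft p.castSucc (O.graft p x m') m) := by
  have key : ∀ m m' : O.X 2, O.comp (n := n + 1) (m := 2) rfl p.castSucc
        (O.comp (n := n) (m := 2) (k := n + 1) rfl p x m) m' =
      O.comp (n := n) (m := 3) (k := n + 2) rfl p x
        (O.comp (n := 2) (m := 2) (k := 3) rfl 0 m m') := fun m m' =>
    (O.comp_seq (n₁ := n) (n₂ := 2) (n₃ := 2) (a := n + 1) (b := 3) (k := n + 2)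
      rfl rfl rfl rfl p 0 x m m').symm
  have h' := O.comp_act (n := n) (m := 3) (k := n + 2) rfl p 1 (Equiv.swap 1 2) x
    (O.comp (n := 2) (m := 2) (k := 3) rfl 0 m' m)
  rw [O.act_one, Equiv.Perm.one_apply] at h'
  rw [graft_graft_eq, graft_graft_eq, succ_succAbove_self, key, key, h, h', ← O.act_mul,
    ← O.act_mul, extendLast_mul_moveLast_self]

theorem graft_graft {n : ℕ} (p q : Fin n) (x : O.X n) {m m' : O.X 2}
    (h : O.GraftCommute m m') :
    O.graft q.castSucc (O.graft p x m) m' =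
      O.act (Equiv.swap (Fin.last (n + 1)) (Fin.last n).castSucc)
        (O.graft p.castSucc (O.graft q x m') m) := by
  rcases lt_trichotomy p q with hpq | rfl | hpq
  · exact O.graft_graft_of_lt hpq x m m'
  · exact graft_graft_self p x h
  -- The case `q < p` is the first case read backwards, the swap being an involution.
  · rw [O.graft_graft_of_lt hpq x m' m, ← O.act_mul, Equiv.swap_mul_self, O.act_one]

theorem Hom.map_graft {P : Operad.{v}} (φ : O.Hom P) {n : ℕ} (p : Fin n) (x : O.X n)
    (m : O.X 2) : φ.toFun (O.graft p x m) = P.graft p (φ.toFun x) (φ.toFun m) := by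
  rw [graft, φ.map_act, φ.map_comp, graft]

/-! ### Operations built by grafting -/

variable (O) in
/-- The operations obtained from the unit by grafting elements of a family of binary operations
and permuting the inputs. -/
def graftClosure {ι : Type v} (μ : ι → O.X 2) : ∀ n : ℕ, Set (O.X n)
  | 0 => ∅
  | 1 => {O.one}
  | n + 2 => {x | ∃ (σ : Equiv.Perm (Fin (n + 2))) (p : Fin (n + 1)) (u : O.X (n + 1)) (y : ι),
      u ∈ graftClosure μ (n + 1) ∧ x = O.act σ (O.graft p u (μ y))}

variable {ι : Type v} {μ : ι → O.X 2}

theorem act_mem_graftClosure {n : ℕ} {x : O.X n} (hx : x ∈ O.graftClosure μ n)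
    (σ : Equiv.Perm (Fin n)) : O.act σ x ∈ O.graftClosure μ n := by
  match n, x, hx with
  | 1, x, hx => rwa [Subsingleton.elim σ 1, O.act_one]
  | n + 2, _, ⟨τ, p, u, y, hu, rfl⟩ => exact ⟨σ * τ, p, u, y, hu, by rw [O.act_mul]⟩

theorem graft_mem_graftClosure {n : ℕ} {x : O.X n} (hx : x ∈ O.graftClosure μ n) (p : Fin n)
    (y : ι) : O.graft p x (μ y) ∈ O.graftClosure μ (n + 1) := by
  match n, x, hx with
  | n + 1, x, hx => exact ⟨1, p, x, y, hx, by rw [O.act_one]⟩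

/-- Induction on the arity of the inner operation: its permutation is pulled out by equivariance,
and the sequential axiom turns its last graft into a graft onto a composite with a smaller inner
operation. -/
theorem comp_mem_graftClosure {n m k : ℕ} (h : k + 1 = n + m) (i : Fin n) {x : O.X n}
    {y : O.X m} (hx : x ∈ O.graftClosure μ n) (hy : y ∈ O.graftClosure μ m) :
    O.comp h i x y ∈ O.graftClosure μ k := by
  induction m generalizing k with
  | zero => exact hy.elim
  | succ m ih =>
    cases m with
    | zero =>
      obtain rfl : y = O.one := hy
      obtain rfl : k = n := by omega
      rwa [O.comp_one]
    | succ m =>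
      obtain ⟨σ, p, u, c, hu, rfl⟩ := hy
      rw [graft, ← O.act_mul]
      set τ := σ * moveLast p
      have h1 := O.comp_act h i 1 τ x (O.comp (n := m + 1) (m := 2) rfl p u (μ c))
      rw [O.act_one, Equiv.Perm.one_apply] at h1
      rw [h1]
      refine act_mem_graftClosure ?_ _
      obtain ⟨a, rfl⟩ : ∃ a, k = a + 1 := ⟨n + m, by omega⟩
      have ha : a + 1 = n + (m + 1) := by omega
      rw [O.comp_seq (n₁ := n) (n₂ := m + 1) (n₃ := 2) ha rfl rfl h i p x u (μ c),
        comp_eq_act_graft]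
      exact act_mem_graftClosure (graft_mem_graftClosure (ih ha hu) _ c) _

theorem graft_zero_one (m : O.X 2) : O.graft 0 O.one m = m := by
  have h : O.comp (n := 1) (m := 2) (k := 2) rfl 0 O.one m = m := O.one_comp m
  rw [graft, h]
  have : moveLast (0 : Fin 1) = 1 := by decide
  rw [this, O.act_one]

theorem mem_graftClosure (y : ι) : μ y ∈ O.graftClosure μ 2 := by
  have := graft_mem_graftClosure (μ := μ) (x := O.one) rfl 0 y
  rwa [graft_zero_one] at this

end Operad

/-! ### Leaves of labelled trees -/

namespace LabelledTree

theorem adj_iff_hasEdge {Y : Type u} {V : Type} (T : LabelledTree Y V) {a b : V} :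
    T.1.graph.Adj a b ↔ ∃ y, T.HasEdge s(a, b) y :=
  ⟨fun h => ⟨_, h, rfl⟩, fun ⟨_, h, _⟩ => h⟩

/-- A leaf of a rooted tree: a vertex other than the root with a single neighbour. -/
def IsLeaf {Y : Type u} {V : Type} (T : LabelledTree Y V) (a : V) : Prop :=
  a ≠ T.1.root ∧ ∀ b c, T.1.graph.Adj a b → T.1.graph.Adj a c → b = c

theorem IsLeaf.of_relabel {Y : Type u} {V W : Type} {σ : V ≃ W} {T : LabelledTree Y V} {a : V}
    (h : (T.relabel σ).IsLeaf (σ a)) : T.IsLeaf a := by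
  refine ⟨fun ha => h.1 (congrArg σ ha), fun b c hb hc => ?_⟩
  exact σ.injective (h.2 _ _ ((SimpleGraph.Iso.map σ T.1.graph).map_adj_iff.2 hb)
    ((SimpleGraph.Iso.map σ T.1.graph).map_adj_iff.2 hc))

theorem IsLeaf.relabel {Y : Type u} {V W : Type} {σ : V ≃ W} {T : LabelledTree Y V} {a : V}
    (h : T.IsLeaf a) : (T.relabel σ).IsLeaf (σ a) := by
  refine ⟨fun ha => h.1 (σ.injective ha), fun b c hb hc => ?_⟩
  obtain ⟨b, rfl⟩ := σ.surjective b
  obtain ⟨c, rfl⟩ := σ.surjective c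
  exact congrArg σ (h.2 _ _ ((SimpleGraph.Iso.map σ T.1.graph).map_adj_iff.1 hb)
    ((SimpleGraph.Iso.map σ T.1.graph).map_adj_iff.1 hc))

end LabelledTree

/-! ### Attaching a leaf to a tree and recovering it -/

theorem hasEdge_edgeTree {Y : Type u} (y w : Y) (e : Sym2 (Fin 2)) :
    (edgeTree y).HasEdge e w ↔ e = s(0, 1) ∧ w = y := by
  have : e ∈ (⊤ : SimpleGraph (Fin 2)).edgeSet ↔ e = s(0, 1) := by
    revert e
    decide
  refine ⟨fun ⟨h, hy⟩ => ⟨this.1 h, hy.symm⟩, fun ⟨h, hy⟩ => ⟨this.2 h, hy.symm⟩⟩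

theorem moveLast_outerVertex {n : ℕ} (p j : Fin n) :
    moveLast p (outerVertex (n := n) (m := 2) (k := n + 1) rfl p 0 j) = j.castSucc := by
  rw [← moveLast_succAbove p j]
  congr 1
  by_cases hj : j = p
  · subst hj
    simp [outerVertex, inner_zero_two]
  · simp [outerVertex, hj, outer_two]

/-- Attaching a new leaf, numbered last, to the vertex `p` by an edge labelled `y`. -/
noncomputable def addLeaf {Y : Type u} {n : ℕ} (p : Fin n) (T : LabelledTree Y (Fin n)) (y : Y) :
    LabelledTree Y (Fin (n + 1)) :=
  (treeComp (n := n) (m := 2) rfl p T (edgeTree y)).relabel (moveLast p)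

theorem graft_edgeTree {Y : Type u} {n : ℕ} (p : Fin n) (T : (NAP Y).X n) (y : Y) :
    (NAP Y).graft p T (edgeTree y) = addLeaf p T y :=
  rfl

section addLeaf

variable {Y : Type u} {n : ℕ} (p : Fin n) (T : LabelledTree Y (Fin n)) (y : Y)

theorem root_addLeaf :
    (addLeaf p T y).1.root = T.1.root.castSucc :=
  moveLast_outerVertex p T.1.root

theorem hasEdge_addLeaf (e : Sym2 (Fin (n + 1))) (w : Y) :
    (addLeaf p T y).HasEdge e w ↔
      (∃ e', T.HasEdge e' w ∧ Sym2.map Fin.castSucc e' = e) ∨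
        e = s(p.castSucc, Fin.last n) ∧ w = y := by
  have h1 : moveLast p (innerVertex (n := n) (m := 2) (k := n + 1) rfl p 0) = p.castSucc := by
    have : innerVertex (n := n) (m := 2) (k := n + 1) rfl p 0 = p.succ.succAbove p := by
      rw [succ_succAbove_self]
      exact inner_zero_two p
    rw [this, moveLast_succAbove]
  have h2 : moveLast p (innerVertex (n := n) (m := 2) (k := n + 1) rfl p 1) = Fin.last n := by
    have : innerVertex (n := n) (m := 2) (k := n + 1) rfl p 1 = p.succ := inner_one_two p
    rw [this, moveLast_succ]
  refine (LabelledTree.hasEdge_relabel (moveLast p)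
    (treeComp (n := n) (m := 2) (k := n + 1) rfl p T (edgeTree y)) e w).trans ?_
  simp only [hasEdge_treeComp]
  rw [or_exists_edge]
  refine or_congr (exists_edge_congr (moveLast_outerVertex p)) ?_
  simp only [hasEdge_edgeTree]
  constructor
  · rintro ⟨_, ⟨rfl, rfl⟩, rfl⟩
    simp [h1, h2]
  · rintro ⟨rfl, rfl⟩
    exact ⟨_, ⟨rfl, rfl⟩, by simp [h1, h2]⟩

theorem last_notMem_map_castSucc (e : Sym2 (Fin n)) :
    Fin.last n ∉ Sym2.map Fin.castSucc e := by
  simp [Sym2.mem_map]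

theorem adj_last_addLeaf {b : Fin (n + 1)} :
    (addLeaf p T y).1.graph.Adj (Fin.last n) b ↔ b = p.castSucc := by
  rw [LabelledTree.adj_iff_hasEdge]
  simp only [hasEdge_addLeaf]
  constructor
  · rintro ⟨w, ⟨e', -, he⟩ | ⟨he, -⟩⟩
    · exact absurd (he ▸ Sym2.mem_mk_left _ _) (last_notMem_map_castSucc e')
    · rw [Sym2.eq_iff] at he
      have := (Fin.castSucc_lt_last p).ne
      grind
  · rintro rfl
    exact ⟨y, Or.inr ⟨Sym2.eq_swap, rfl⟩⟩

theorem adj_castSucc_addLeaf {a b : Fin n} (h : T.1.graph.Adj a b) :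
    (addLeaf p T y).1.graph.Adj a.castSucc b.castSucc := by
  obtain ⟨w, hw⟩ := T.adj_iff_hasEdge.1 h
  refine (LabelledTree.adj_iff_hasEdge _).2 ⟨w, ?_⟩
  exact (hasEdge_addLeaf ..).2 (Or.inl ⟨_, hw, rfl⟩)

theorem isLeaf_last_addLeaf :
    (addLeaf p T y).IsLeaf (Fin.last n) := by
  refine ⟨?_, fun b c hb hc => ?_⟩
  · rw [root_addLeaf]
    exact (Fin.castSucc_lt_last _).ne'
  · rw [adj_last_addLeaf] at hb hc
    rw [hb, hc]

variable {p T y}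

/-- The vertex `p` cannot be a leaf after the attachment: if it is not the root, it already has a
neighbour in `T`, and the new leaf is a second one. -/
theorem LabelledTree.IsLeaf.of_addLeaf {a : Fin n}
    (h : (addLeaf p T y).IsLeaf a.castSucc) :
    T.IsLeaf a ∧ a ≠ p := by
  have hr : a ≠ T.1.root := by
    have := h.1
    rw [root_addLeaf] at this
    exact fun h' => this (congrArg _ h')
  refine ⟨⟨hr, fun b c hb hc => ?_⟩, ?_⟩
  · exact Fin.castSucc_injective _ (h.2 _ _ (adj_castSucc_addLeaf p T y hb)
      (adj_castSucc_addLeaf p T y hc))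
  · rintro rfl
    have : Nontrivial (Fin n) := ⟨_, _, hr⟩
    obtain ⟨c, hc⟩ := T.1.isTree.connected.preconnected.exists_adj_of_nontrivial a
    have := h.2 _ _ (adj_castSucc_addLeaf a T y hc)
      ((adj_last_addLeaf a T y).2 rfl).symm
    exact (Fin.castSucc_lt_last _).ne this

/-- Only one edge contains the last vertex; it reveals the point of attachment and the label. The
remaining edges and the root are those of the smaller tree. -/
theorem addLeaf_inj {p' : Fin n} {T' : LabelledTree Y (Fin n)} {y' : Y}
    (h : addLeaf p T y = addLeaf p' T' y') :
    p = p' ∧ T = T' ∧ y = y' := by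
  have he := fun e w => iff_of_eq (congrArg (fun S => LabelledTree.HasEdge S e w) h)
  simp only [hasEdge_addLeaf] at he
  have hl : ∀ (e : Sym2 (Fin n)) (q : Fin n), Sym2.map Fin.castSucc e ≠ s(q.castSucc, Fin.last n) :=
    fun e q heq => last_notMem_map_castSucc e (heq ▸ Sym2.mem_mk_right _ _)
  have hp : p = p' ∧ y = y' := by
    rcases (he _ _).1 (Or.inr ⟨rfl, rfl⟩) with ⟨e', -, h'⟩ | ⟨h1, h2⟩
    · exact (hl _ _ h').elim
    · exact ⟨by simpa using h1, h2⟩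
  refine ⟨hp.1, LabelledTree.ext' ?_ fun e w => ?_, hp.2⟩
  · have := congrArg (fun S : LabelledTree Y (Fin (n + 1)) => S.1.root) h
    rw [root_addLeaf, root_addLeaf] at this
    exact Fin.castSucc_injective _ this
  · have := he (Sym2.map Fin.castSucc e) w
    simpa [hl, (Sym2.map.injective (Fin.castSucc_injective n)).eq_iff] using this

end addLeaf

theorem eq_pointTree {Y : Type u} (T : LabelledTree Y (Fin 1)) : T = pointTree Y := by
  refine LabelledTree.ext' (Subsingleton.elim _ _) fun e y => ?_
  refine ⟨fun ⟨he, _⟩ => ?_, fun h => (not_hasEdge_pointTree _ _ h).elim⟩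
  induction e with | _ a b
  exact (T.1.graph.ne_of_adj he (Subsingleton.elim _ _)).elim

/-- Every rooted tree with at least two vertices arises by adding a leaf. -/
theorem exists_eq_relabel_addLeaf (Y : Type u) {n : ℕ} (T : RootedTree (Fin (n + 2))) :
    ∃ (σ : Equiv.Perm (Fin (n + 2))) (p : Fin (n + 1)) (W : RootedTree (Fin (n + 1)))
      (κ : W.graph.edgeSet → T.graph.edgeSet) (e₀ : T.graph.edgeSet),
      ∀ l : T.graph.edgeSet → Y, (⟨T, l⟩ : LabelledTree Y (Fin (n + 2))) =
        (addLeaf p ⟨W, l ∘ κ⟩ (l e₀)).relabel σ := by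
  classical
  -- A tree with at least two vertices has two vertices of degree one, and one of them is not the
  -- root.
  obtain ⟨a, har, ha⟩ : ∃ a, a ≠ T.root ∧ T.graph.degree a = 1 := by
    obtain ⟨b, c, hbc, hb, hc⟩ := T.isTree.exists_ne_and_degree_eq_one
    by_cases h : b = T.root
    · exact ⟨c, fun h' => hbc (h.trans h'.symm), hc⟩
    · exact ⟨b, h, hb⟩
  have hconn := T.isTree.connected.induce_compl_singleton_of_degree_eq_one ha
  obtain ⟨q, hq, hq'⟩ := SimpleGraph.degree_eq_one_iff_existsUnique_adj.1 ha
  -- The permutation brings the leaf `a` to the last place, so that `f` enumerates the vertices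
  -- other than `a`.
  let σ : Equiv.Perm (Fin (n + 2)) := Equiv.swap (Fin.last (n + 1)) a
  have hσ : σ (Fin.last _) = a := Equiv.swap_apply_left _ _
  let f : Fin (n + 1) ↪ Fin (n + 2) := Fin.castSuccEmb.trans σ.toEmbedding
  have hf : ∀ j, f j = σ j.castSucc := fun j => rfl
  have hfa : ∀ j, f j ≠ a := fun j hj =>
    (Fin.castSucc_lt_last j).ne (σ.injective ((hf j ▸ hj).trans hσ.symm))
  have hfs : ∀ b, b ≠ a → ∃ j, f j = b := by
    intro b hb
    obtain ⟨c, rfl⟩ := σ.surjective b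
    induction c using Fin.lastCases with
    | last => exact (hb hσ).elim
    | cast j => exact ⟨j, rfl⟩
  obtain ⟨r, hr⟩ := hfs T.root har.symm
  obtain ⟨p, hp⟩ := hfs q hq.ne'
  let ψ : T.graph.comap f ≃g T.graph.induce {a}ᶜ :=
    { Equiv.ofBijective (fun j => (⟨f j, hfa j⟩ : ({a}ᶜ : Set (Fin (n + 2)))))
        ⟨fun i j hij => f.injective (congrArg Subtype.val hij), fun ⟨b, hb⟩ => by
          obtain ⟨j, hj⟩ := hfs b hb
          exact ⟨j, Subtype.ext hj⟩⟩ with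
      map_rel_iff' := Iff.rfl }
  let W : RootedTree (Fin (n + 1)) :=
    ⟨T.graph.comap f, ⟨ψ.connected_iff.2 hconn, T.isTree.isAcyclic.of_comap f⟩, r⟩
  have hκ : ∀ e : Sym2 (Fin (n + 1)), e ∈ W.graph.edgeSet ↔ Sym2.map f e ∈ T.graph.edgeSet := by
    intro e
    induction e with | _ b c
    rfl
  -- All data are fixed before the labelling `l` enters; this uniformity is what continuity of the
  -- inverse will need.
  refine ⟨σ, p, W, fun e => ⟨Sym2.map f e.1, (hκ _).1 e.2⟩, ⟨s(q, a), hq.symm⟩, fun l => ?_⟩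
  refine LabelledTree.ext' ?_ fun e y => ?_
  · refine hr.symm.trans ((hf r).trans (congrArg σ ?_))
    exact (root_addLeaf p (⟨W, _⟩ : LabelledTree Y (Fin (n + 1))) _).symm
  · refine Iff.trans ?_ (LabelledTree.hasEdge_relabel σ _ e y).symm
    simp only [hasEdge_addLeaf]
    constructor
    · rintro ⟨he, rfl⟩
      by_cases hae : a ∈ e
      · obtain ⟨b, rfl⟩ := hae
        obtain rfl := hq' b he
        refine ⟨s(p.castSucc, Fin.last _), Or.inr ⟨rfl, ?_⟩, ?_⟩
        · exact congrArg l (Subtype.ext Sym2.eq_swap)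
        · rw [Sym2.map_mk, ← hf, hp, hσ, Sym2.eq_swap]
      · obtain ⟨e', rfl⟩ : ∃ e', Sym2.map f e' = e := by
          induction e with | _ b c
          simp only [Sym2.mem_iff, not_or] at hae
          obtain ⟨i, rfl⟩ := hfs b (Ne.symm hae.1)
          obtain ⟨j, rfl⟩ := hfs c (Ne.symm hae.2)
          exact ⟨s(i, j), rfl⟩
        refine ⟨Sym2.map Fin.castSucc e', Or.inl ⟨e', ⟨(hκ _).2 he, rfl⟩, rfl⟩, ?_⟩
        rw [Sym2.map_map]
        rfl
    · rintro ⟨_, ⟨e', ⟨he', hy⟩, rfl⟩ | ⟨rfl, rfl⟩, rfl⟩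
      · rw [Sym2.map_map]
        exact ⟨(hκ _).1 he', hy⟩
      · simp only [Sym2.map_mk, ← hf, hp, hσ]
        exact ⟨hq.symm, rfl⟩

/-- The generators are all binary trees, while grafting uses only those rooted at `0`; up to
permutation nothing is lost. -/
theorem eq_relabel_edgeTree {Y : Type u} (T : LabelledTree Y (Fin 2)) :
    ∃ (σ : Equiv.Perm (Fin 2)) (y : Y), T = (edgeTree y).relabel σ := by
  obtain ⟨T, l⟩ := T
  obtain ⟨σ, p, W, κ, e₀, h⟩ := exists_eq_relabel_addLeaf Y (n := 0) T
  refine ⟨σ, l e₀, ?_⟩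
  obtain rfl : p = 0 := Subsingleton.elim (α := Fin 1) _ _
  rw [h, eq_pointTree ⟨W, l ∘ κ⟩]
  exact congrArg (LabelledTree.relabel σ) (Operad.graft_zero_one (O := NAP Y) (edgeTree (l e₀)))

/-! ### Operads built by grafting that map to `NAP` -/

section comparison

variable {Y : Type v} {O : Operad.{u}} {μ : Y → O.X 2} {φ : O.Hom (NAP Y)}

theorem map_graft_eq_addLeaf (hφ : ∀ y, φ.toFun (μ y) = edgeTree y) {n : ℕ} (p : Fin n)
    (x : O.X n) (y : Y) : φ.toFun (O.graft p x (μ y)) = addLeaf p (φ.toFun x) y := by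
  rw [φ.map_graft, hφ, graft_edgeTree]

/-- Any leaf of the tree can be taken to be grafted last. If it is not already so, it is a leaf of
the previous tree away from `p`; by induction it is last there, and the final two grafts are
exchanged. -/
theorem exists_eq_act_graft_of_isLeaf (hφ : ∀ y, φ.toFun (μ y) = edgeTree y)
    (hμ : ∀ y z, O.GraftCommute (μ y) (μ z)) {n : ℕ} {x : O.X (n + 2)}
    (hx : x ∈ O.graftClosure μ (n + 2)) {a : Fin (n + 2)}
    (ha : LabelledTree.IsLeaf (φ.toFun x) a) :
    ∃ (σ : Equiv.Perm (Fin (n + 2))) (p : Fin (n + 1)) (u : O.X (n + 1)) (y : Y),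
      u ∈ O.graftClosure μ (n + 1) ∧ x = O.act σ (O.graft p u (μ y)) ∧ σ (Fin.last _) = a := by
  induction n with
  | zero =>
    obtain ⟨σ, p, u, y, hu, rfl⟩ := hx
    obtain ⟨b, rfl⟩ := σ.surjective a
    rw [φ.map_act, map_graft_eq_addLeaf hφ] at ha
    have hb := LabelledTree.IsLeaf.of_relabel (σ := σ) ha
    induction b using Fin.lastCases with
    | last => exact ⟨σ, p, u, y, hu, rfl, rfl⟩
    -- The only old vertex is the root, which is never a leaf.
    | cast c => exact (hb.of_addLeaf.1.1 (Subsingleton.elim (α := Fin 1) _ _)).elim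
  | succ n ih =>
    obtain ⟨σ, p, u, y, hu, rfl⟩ := hx
    obtain ⟨b, rfl⟩ := σ.surjective a
    rw [φ.map_act, map_graft_eq_addLeaf hφ] at ha
    have hb := LabelledTree.IsLeaf.of_relabel (σ := σ) ha
    induction b using Fin.lastCases with
    | last => exact ⟨σ, p, u, y, hu, rfl, rfl⟩
    | cast c =>
      obtain ⟨hc, hcp⟩ := hb.of_addLeaf
      obtain ⟨τ, r, v, z, hv, rfl, rfl⟩ := ih hu hc
      obtain ⟨s, rfl⟩ := τ.surjective p
      induction s using Fin.lastCases with
      -- Here the leaf would be grafted onto itself, which is excluded by `c ≠ p`.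
      | last => exact (hcp rfl).elim
      | cast s =>
        refine ⟨σ * (extendLast τ * Equiv.swap (Fin.last (n + 2)) (Fin.last (n + 1)).castSucc),
          r.castSucc, O.graft s v (μ y), z, Operad.graft_mem_graftClosure hv s y, ?_, ?_⟩
        · rw [O.graft_act, Operad.graft_graft r s v (hμ z y), O.act_mul, O.act_mul]
        · simp

/-- The leaf grafted last in `x'` is also made the last one in `x`. Injectivity of `addLeaf` then
matches the attachment data, and the claim descends to the smaller operations. -/
theorem eq_of_map_eq (hφ : ∀ y, φ.toFun (μ y) = edgeTree y)
    (hμ : ∀ y z, O.GraftCommute (μ y) (μ z)) {n : ℕ} {x x' : O.X n}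
    (hx : x ∈ O.graftClosure μ n) (hx' : x' ∈ O.graftClosure μ n)
    (h : φ.toFun x = φ.toFun x') : x = x' := by
  match n, x, x', hx, hx', h with
  | 1, _, _, rfl, rfl, _ => rfl
  | n + 2, x, x', hx, hx', h =>
    obtain ⟨σ', p', u', y', hu', rfl⟩ := hx'
    have hl : LabelledTree.IsLeaf (φ.toFun x) (σ' (Fin.last _)) := by
      rw [h, φ.map_act, map_graft_eq_addLeaf hφ]
      exact LabelledTree.IsLeaf.relabel (isLeaf_last_addLeaf p' (φ.toFun u') y')
    obtain ⟨σ, p, u, y, hu, rfl, hσ⟩ := exists_eq_act_graft_of_isLeaf hφ hμ hx hl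
    -- Both permutations send the last input to the same leaf, so their quotient comes from a
    -- permutation `τ` of the smaller operation.
    obtain ⟨τ, hτ⟩ := exists_extendLast_eq (σ⁻¹ * σ') (by simp [← hσ])
    obtain rfl : σ * extendLast τ = σ' := by rw [hτ, mul_inv_cancel_left]
    rw [O.act_mul, ← O.graft_act] at h ⊢
    rw [φ.map_act, φ.map_act, map_graft_eq_addLeaf hφ, map_graft_eq_addLeaf hφ] at h
    obtain ⟨hp, hT, rfl⟩ := addLeaf_inj ((NAP Y).act_injective σ h)
    rw [hp, eq_of_map_eq hφ hμ hu (Operad.act_mem_graftClosure hu' τ) hT]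

theorem exists_map_eq (hφ : ∀ y, φ.toFun (μ y) = edgeTree y) {n : ℕ}
    (T : LabelledTree Y (Fin n)) : ∃ x ∈ O.graftClosure μ n, φ.toFun x = T := by
  match n, T with
  | 0, T => exact T.1.root.elim0
  | 1, T =>
    rw [eq_pointTree T]
    exact ⟨O.one, rfl, φ.map_one⟩
  | n + 2, ⟨T, l⟩ =>
    obtain ⟨σ, p, W, κ, e₀, h⟩ := exists_eq_relabel_addLeaf Y T
    obtain ⟨w, hw, hw'⟩ := exists_map_eq hφ (⟨W, l ∘ κ⟩ : LabelledTree Y (Fin (n + 1)))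
    refine ⟨O.act σ (O.graft p w (μ (l e₀))), ⟨σ, p, w, _, hw, rfl⟩, ?_⟩
    rw [φ.map_act, map_graft_eq_addLeaf hφ, hw', h]
    rfl

theorem bijective_of_graftClosure (hφ : ∀ y, φ.toFun (μ y) = edgeTree y)
    (hμ : ∀ y z, O.GraftCommute (μ y) (μ z)) (hO : ∀ n (x : O.X n), x ∈ O.graftClosure μ n)
    (n : ℕ) : Function.Bijective (φ.toFun : O.X n → (NAP Y).X n) :=
  ⟨fun _ _ h => eq_of_map_eq hφ hμ (hO _ _) (hO _ _) h, fun T =>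
    let ⟨x, _, hx⟩ := exists_map_eq hφ T
    ⟨x, hx⟩⟩

theorem continuous_graft {t : ∀ n, TopologicalSpace (O.X n)} (ht : O.IsTopological t) {n : ℕ}
    (p : Fin n) : Continuous fun z : O.X n × O.X 2 => O.graft p z.1 z.2 :=
  (ht.continuous_act _).comp (ht.continuous_comp (n := n) (m := 2) rfl p)

/-- A section of `φ` is continuous. -/
theorem continuous_section [TopologicalSpace Y] {t : ∀ n, TopologicalSpace (O.X n)}
    (ht : O.IsTopological t) (hc : Continuous μ) (hφ : ∀ y, φ.toFun (μ y) = edgeTree y)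
    {ψ : ∀ n, (NAP Y).X n → O.X n} (hψ : ∀ n x, ψ n (φ.toFun x) = x)
    (hψ' : ∀ n T, φ.toFun (ψ n T) = T) (n : ℕ) : Continuous (ψ n) := by
  refine continuous_sigma fun T => ?_
  match n, T with
  | 0, T => exact T.root.elim0
  | 1, T =>
    have : IsEmpty T.graph.edgeSet := ⟨fun ⟨e, he⟩ => by
      induction e with | _ a b
      exact T.graph.ne_of_adj he (Subsingleton.elim _ _)⟩
    exact continuous_of_const fun l l' => by rw [Subsingleton.elim l l']
  | n + 2, T =>
    obtain ⟨σ, p, W, κ, e₀, h⟩ := exists_eq_relabel_addLeaf Y T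
    -- On the piece of shape `T`, the section is grafting applied to the section in lower arity and
    -- to one coordinate of `l`, with everything else independent of `l`.
    have key : ∀ l : T.graph.edgeSet → Y, ψ (n + 2) ⟨T, l⟩ =
        O.act σ (O.graft p (ψ (n + 1) ⟨W, l ∘ κ⟩) (μ (l e₀))) := by
      intro l
      rw [← hψ _ (O.act _ _), φ.map_act, map_graft_eq_addLeaf hφ]
      exact congrArg (ψ _) ((h l).trans (congrArg (fun S => (addLeaf p S (l e₀)).relabel σ)
        (hψ' (n + 1) (⟨W, l ∘ κ⟩ : LabelledTree Y (Fin (n + 1)))).symm))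
    have ih := continuous_section ht hc hφ hψ hψ' (n + 1)
    have h1 : Continuous fun l : T.graph.edgeSet → Y =>
        ψ (n + 1) (⟨W, l ∘ κ⟩ : LabelledTree Y (Fin (n + 1))) :=
      ih.comp (continuous_sigmaMk.comp (continuous_pi fun e => continuous_apply (κ e)))
    exact (((ht.continuous_act σ).comp ((continuous_graft ht p).comp
      (h1.prodMk (hc.comp (continuous_apply e₀))))).congr fun l => (key l).symm :)

end comparison

/-! ### The topological operad `NAP` -/

theorem LabelledTree.continuous_relabel {Y : Type u} [TopologicalSpace Y] {V W : Type}
    (σ : V ≃ W) : Continuous (LabelledTree.relabel σ : LabelledTree Y V → LabelledTree Y W) := by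
  refine continuous_sigma fun T => ?_
  have h : Continuous fun l : T.graph.edgeSet → Y =>
      l ∘ (SimpleGraph.Iso.map σ T.graph).mapEdgeSet.symm :=
    continuous_pi fun e => continuous_apply _
  exact (continuous_sigmaMk (σ := fun T : RootedTree W => T.graph.edgeSet → Y)
    (i := ⟨_, (SimpleGraph.Iso.map σ T.graph).isTree_iff.1 T.isTree, σ T.root⟩)).comp h

theorem continuous_treeComp {Y : Type u} [TopologicalSpace Y] {n m k : ℕ} (h : k + 1 = n + m)
    (i : Fin n) : Continuous fun p : LabelledTree Y (Fin n) × LabelledTree Y (Fin m) =>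
      treeComp h i p.1 p.2 := by
  refine continuous_iff_continuousAt.2 fun ⟨⟨T, l⟩, ⟨T', l'⟩⟩ => ?_
  -- Continuity is local, and fixing both shapes gives an open piece of the product; there the
  -- composite has constant shape and its labels are coordinates of the two labellings.
  have hopen := (Topology.IsOpenEmbedding.sigmaMk (σ := fun T : RootedTree (Fin n) =>
    T.graph.edgeSet → Y) (i := T)).prodMap (Topology.IsOpenEmbedding.sigmaMk
      (σ := fun T : RootedTree (Fin m) => T.graph.edgeSet → Y) (i := T'))
  refine (hopen.continuousAt_iff (x := (l, l'))).1 (Continuous.continuousAt ?_)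
  have hc : Continuous fun p : (T.graph.edgeSet → Y) × (T'.graph.edgeSet → Y) =>
      Sum.elim p.1 p.2 ∘ ((gluing_vertex h i T'.root).edgeEquiv T.graph T'.graph).symm := by
    refine continuous_pi fun e => ?_
    simp only [Function.comp_apply]
    rcases ((gluing_vertex h i T'.root).edgeEquiv T.graph T'.graph).symm e with e' | e'
    · exact (continuous_apply e').comp continuous_fst
    · exact (continuous_apply e').comp continuous_snd
  exact (continuous_sigmaMk (σ := fun T : RootedTree (Fin k) => T.graph.edgeSet → Y)
    (i := ⟨_, (gluing_vertex h i T'.root).isTree T.isTree T'.isTree (by simpa using h),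
      outerVertex h i T'.root T.root⟩)).comp hc

theorem isTopological_NAP (Y : Type u) [TopologicalSpace Y] :
    (NAP Y).IsTopological fun _ => inferInstance where
  continuous_act σ := LabelledTree.continuous_relabel σ
  continuous_comp h i := continuous_treeComp h i

theorem continuous_edgeTree (Y : Type u) [TopologicalSpace Y] :
    Continuous (edgeTree : Y → LabelledTree Y (Fin 2)) :=
  continuous_sigmaMk.comp (continuous_pi fun _ => continuous_id)

/-! ### Presentations -/

theorem Operad.Ideal.map_eq {O : Operad.{u}} {P : Operad.{v}} {R : O.Relations} (f : O.Hom P)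
    (hf : ∀ n x y, R n x y → f.toFun x = f.toFun y) {n : ℕ} {x y : O.X n} (h : O.Ideal R x y) :
    f.toFun x = f.toFun y := by
  induction h with
  | of h => exact hf _ _ _ h
  | refl x => rfl
  | symm _ ih => exact ih.symm
  | trans _ _ ih₁ ih₂ => exact ih₁.trans ih₂
  | act σ _ ih => rw [f.map_act, f.map_act, ih]
  | comp h i _ _ ih₁ ih₂ => rw [f.map_comp, f.map_comp, ih₁, ih₂]

/-- The morphism out of a quotient operad induced by a morphism that respects the relations. -/
def Operad.quotientLift {O : Operad.{u}} {P : Operad.{v}} {R : O.Relations} (f : O.Hom P)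
    (hf : ∀ n x y, R n x y → f.toFun x = f.toFun y) : (O.quotient R).Hom P where
  toFun := Quotient.lift f.toFun fun _ _ h => Operad.Ideal.map_eq f hf h
  map_act := by
    rintro n σ ⟨x⟩
    exact f.map_act σ x
  map_one := f.map_one
  map_comp := by
    rintro n m k h i ⟨x⟩ ⟨y⟩
    exact f.map_comp h i x y

/-- The binary generator of the presented operad given by the edge labelled by `y`. -/
noncomputable def presentedEdge {Y : Type u} (R : (freeOperad (NAP Y).binary).Relations) (y : Y) :
    ((freeOperad (NAP Y).binary).quotient R).X 2 :=
  presentedGen (E := (NAP Y).binary) R ⟨edgeTree y, rfl⟩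

/-- Elements are represented by formal expressions, and iterated grafts contain the generators and
are stable under all operations. No condition on `R` is needed here. -/
theorem mem_graftClosure_presentedEdge {Y : Type u} (R : (freeOperad (NAP Y).binary).Relations)
    (n : ℕ) (x : ((freeOperad (NAP Y).binary).quotient R).X n) :
    x ∈ ((freeOperad (NAP Y).binary).quotient R).graftClosure (presentedEdge R) n := by
  obtain ⟨x, rfl⟩ := Quot.exists_rep x
  obtain ⟨x, rfl⟩ := Quot.exists_rep x
  induction x with
  | gen e =>
    obtain ⟨T, rfl⟩ := e
    obtain ⟨σ, y, rfl⟩ := eq_relabel_edgeTree T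
    have h : presentedGen R (E := (NAP Y).binary) ⟨(edgeTree y).relabel σ, rfl⟩ =
        ((freeOperad (NAP Y).binary).quotient R).act σ (presentedEdge R y) :=
      congrArg ((freeOperad (NAP Y).binary).toQuotient R).toFun
        ((freeGen (NAP Y).binary).map_act σ ⟨edgeTree y, rfl⟩)
    exact Set.mem_of_eq_of_mem h
      (Operad.act_mem_graftClosure (Operad.mem_graftClosure y) σ)
  | one => exact rfl
  | act σ x ih => exact Operad.act_mem_graftClosure ih σ
  | comp h i x y ihx ihy => exact Operad.comp_mem_graftClosure h i ihx ihy

/-- Both sides are the tree with root `0` and two leaves, `1` with label `z` and `2` with label `y`.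
-/
theorem graftCommute_edgeTree {Y : Type u} (y z : Y) :
    (NAP Y).GraftCommute (edgeTree y) (edgeTree z) := by
  have ho : ∀ e : Sym2 (Fin 2), e = s(0, 1) →
      Sym2.map (outerVertex (n := 2) (m := 2) (k := 3) rfl 0 0) e = s(0, 2) := by
    rintro _ rfl
    decide
  have hi : ∀ e : Sym2 (Fin 2), e = s(0, 1) →
      Sym2.map (innerVertex (n := 2) (m := 2) (k := 3) rfl 0) e = s(0, 1) := by
    rintro _ rfl
    decide
  have key : ∀ (y z w : Y) (e : Sym2 (Fin 3)),
      (treeComp (n := 2) (m := 2) (k := 3) rfl 0 (edgeTree y) (edgeTree z)).HasEdge e w ↔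
        e = s(0, 2) ∧ w = y ∨ e = s(0, 1) ∧ w = z := by
    intro y z w e
    rw [hasEdge_treeComp]
    simp only [hasEdge_edgeTree]
    refine or_congr ⟨?_, ?_⟩ ⟨?_, ?_⟩
    · rintro ⟨e', ⟨he, hw⟩, rfl⟩
      exact ⟨ho e' he, hw⟩
    · rintro ⟨rfl, hw⟩
      exact ⟨_, ⟨rfl, hw⟩, ho _ rfl⟩
    · rintro ⟨e', ⟨he, hw⟩, rfl⟩
      exact ⟨hi e' he, hw⟩
    · rintro ⟨rfl, hw⟩
      exact ⟨_, ⟨rfl, hw⟩, hi _ rfl⟩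
  refine LabelledTree.ext' ?_ fun e w => ?_
  · have hr : ∀ y z : Y, (treeComp (n := 2) (m := 2) (k := 3) rfl 0 (edgeTree y)
        (edgeTree z)).1.root = 0 := fun _ _ => rfl
    exact (hr y z).trans (congrArg (Equiv.swap 1 2) (hr z y)).symm
  · refine (key y z w e).trans (Iff.trans ?_ (LabelledTree.hasEdge_relabel _ _ e w).symm)
    refine Iff.trans ?_ (exists_congr fun e' => and_congr_left' (key z y w e')).symm
    constructor
    · rintro (⟨rfl, rfl⟩ | ⟨rfl, rfl⟩)
      · exact ⟨s(0, 1), Or.inr ⟨rfl, rfl⟩, by decide⟩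
      · exact ⟨s(0, 2), Or.inl ⟨rfl, rfl⟩, by decide⟩
    · rintro ⟨_, ⟨rfl, rfl⟩ | ⟨rfl, rfl⟩, rfl⟩
      · exact Or.inr ⟨by decide, rfl⟩
      · exact Or.inl ⟨by decide, rfl⟩

/-- A morphism from a presented operad to a topological operad is continuous if it is so on
the generators. -/
theorem continuous_of_presentedGen {E : SymCollection.{u}} [∀ n, TopologicalSpace (E.X n)]
    {R : (freeOperad E).Relations} {P : Operad.{v}} {t : ∀ n, TopologicalSpace (P.X n)}
    (hP : P.IsTopological t) (φ : ((freeOperad E).quotient R).Hom P)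
    (hφ : ∀ n, Continuous fun e : E.X n => φ.toFun (presentedGen R e)) (n : ℕ) :
    @Continuous _ _ (presentedTopology R n) _
      (φ.toFun : ((freeOperad E).quotient R).X n → P.X n) := by
  -- The pulled-back topologies form a presentation topology, and the presented topology, being the
  -- infimum, is finer.
  have h : IsPresentationTopology R fun n => (t n).induced
      (φ.toFun : ((freeOperad E).quotient R).X n → P.X n) := by
    let : ∀ n, TopologicalSpace (((freeOperad E).quotient R).X n) := fun n =>
      (t n).induced φ.toFun
    have hc : ∀ n, Continuous (φ.toFun : ((freeOperad E).quotient R).X n → P.X n) := fun n =>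
      continuous_induced_dom
    refine ⟨⟨fun {n} σ => ?_, fun {n m k} h i => ?_⟩, fun n => continuous_induced_rng.2 (hφ n)⟩
    · refine continuous_induced_rng.2 ?_
      exact ((hP.continuous_act σ).comp (hc n)).congr fun x => (φ.map_act σ x).symm
    · refine continuous_induced_rng.2 ?_
      exact ((hP.continuous_comp h i).comp ((hc n).prodMap (hc m))).congr fun p =>
        (φ.map_comp h i p.1 p.2).symm
  exact continuous_iff_le_induced.2 (sInf_le ⟨_, h, rfl⟩)

/-- A common criterion for both presentations: the first hypothesis makes the morphism to `NAP Y`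
well defined, the second gives the exchange of grafts in the quotient. -/
theorem isPresentedBy_NAP {Y : Type u} [TopologicalSpace Y]
    {R : (freeOperad (NAP Y).binary).Relations}
    (hR : ∀ n x y, R n x y →
      (freeLift (NAP Y).binaryIncl).toFun x = (freeLift (NAP Y).binaryIncl).toFun y)
    (hR' : ∀ n x y, napRelations Y n x y → (freeOperad (NAP Y).binary).Ideal R x y) :
    (NAP Y).IsPresentedBy R := by
  let φ := Operad.quotientLift (freeLift (NAP Y).binaryIncl) hR
  have hφ : ∀ y, φ.toFun (presentedEdge R y) = edgeTree y := fun y => rfl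
  have hμ : ∀ y z, ((freeOperad (NAP Y).binary).quotient R).GraftCommute (presentedEdge R y)
      (presentedEdge R z) := fun y z => Quotient.sound (hR' _ _ _ (napRelations.rel y z))
  have hb := bijective_of_graftClosure hφ hμ (mem_graftClosure_presentedEdge R)
  refine ⟨φ, fun n e => rfl, fun n => ?_⟩
  let : ∀ n, TopologicalSpace (((freeOperad (NAP Y).binary).quotient R).X n) :=
    presentedTopology R
  have ht := isPresentationTopology_presentedTopology R
  have hc : Continuous (presentedEdge R) :=
    (ht.2 2).comp ((continuous_edgeTree Y).subtype_mk _)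
  let ψ := fun n => (Equiv.ofBijective _ (hb n)).symm
  refine isHomeomorph_iff_exists_inverse.2 ⟨?_, ψ n, ?_, ?_, ?_⟩
  · exact continuous_of_presentedGen (isTopological_NAP Y) φ (fun n => continuous_subtype_val) n
  · exact (Equiv.ofBijective _ (hb n)).symm_apply_apply
  · exact (Equiv.ofBijective _ (hb n)).apply_symm_apply
  · exact continuous_section (φ := φ) ht.1 hc hφ
      (fun n => (Equiv.ofBijective _ (hb n)).symm_apply_apply)
      (fun n => (Equiv.ofBijective _ (hb n)).apply_symm_apply) n

theorem napRelations.map_eq {Y : Type u} {n : ℕ} {x y : (freeOperad (NAP Y).binary).X n}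
    (h : napRelations Y n x y) :
    (freeLift (NAP Y).binaryIncl).toFun x = (freeLift (NAP Y).binaryIncl).toFun y := by
  obtain ⟨y, z⟩ := h
  exact graftCommute_edgeTree y z

theorem napRelations.quadraticRelations {Y : Type u} {n : ℕ}
    {x y : (freeOperad (NAP Y).binary).X n} (h : napRelations Y n x y) :
    (NAP Y).quadraticRelations n x y := by
  refine ⟨?_, ?_, h.map_eq⟩ <;> obtain ⟨y, z⟩ := h <;> rfl

theorem Operad.generated_of_mem_graftClosure {O : Operad.{u}} {ι : Type v} {μ : ι → O.X 2}
    {S : ∀ n, Set (O.X n)} (hS : ∀ y, μ y ∈ S 2) {n : ℕ} {x : O.X n}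
    (hx : x ∈ O.graftClosure μ n) : O.Generated S x := by
  match n, x, hx with
  | 1, _, rfl => exact .one
  | n + 2, _, ⟨σ, p, u, y, hu, rfl⟩ =>
    exact .act _ (.act _ (.comp _ _ (generated_of_mem_graftClosure hS hu) (.of (hS y))))

theorem isBinaryGenerated_NAP (Y : Type u) : (NAP Y).IsBinaryGenerated := by
  intro n T
  -- For the identity morphism, surjectivity from iterated grafts says that `NAP Y` consists of
  -- iterated grafts of edge trees.
  let φ : (NAP Y).Hom (NAP Y) := ⟨⟨id, fun _ _ => rfl⟩, rfl, fun _ _ _ _ => rfl⟩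
  obtain ⟨_, hx, rfl⟩ := exists_map_eq (φ := φ) (μ := edgeTree) (fun y => rfl) T
  exact Operad.generated_of_mem_graftClosure (fun _ => rfl) hx

end TreeOperad

theorem mainTheorem12 (Y : Type*) [TopologicalSpace Y] :
    (TreeOperad.NAP Y).IsTopological (fun _ => inferInstance) ∧
    (TreeOperad.NAP Y).IsBinaryGenerated ∧
    (TreeOperad.NAP Y).IsPresentedBy (TreeOperad.NAP Y).quadraticRelations ∧
    (TreeOperad.NAP Y).IsPresentedBy (TreeOperad.napRelations Y) := by
  refine ⟨TreeOperad.isTopological_NAP Y, TreeOperad.isBinaryGenerated_NAP Y,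
    TreeOperad.isPresentedBy_NAP (fun _ _ _ h => h.2.2) fun _ _ _ h => ?_,
    TreeOperad.isPresentedBy_NAP (fun _ _ _ h => h.map_eq) fun _ _ _ h => .of h⟩
  exact .of h.quadraticRelations
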